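/- Let $N\in\mathbb N$, let $\Omega\subset\mathbb R^N$ be measurable, let $\mathfrak m$ be Lebesgue measure and let $1\le p<\infty$. Let $\mathscr F:\mathbb R^N\to\mathbb R^N$ be globally Lipschitz, with flow $\Phi$ ($\partial_t\Phi(x,t)=\mathscr F(\Phi(x,t))$, $\Phi(x,0)=x$), and put $\varphi_t(x)=\Phi(x,-t)$. Let $h$ be real-valued, measurable and bounded below on $\Omega$, and put $\nu=h+\operatorname{div}\mathscr F$. Put $\tau_\pm(x)=\inf\{s>0:\Phi(x,\pm s)\notin\Omega\}$ (with $\inf\varnothing=\infty$) and, on the complex space $L^p(\Omega,\mathfrak m)$, for $t\ge 0$, $$\mathcal U(t)f(x)=\exp\Big(-\int_0^t\nu(\varphi_s(x))\,ds\Big)\,f(\varphi_t(x))\,\chi_{\{t<\tau_-(x)\}}(x).$$ Let $\Omega_3=\{x\in\Omega:\tau_+(x)=\tau_-(x)=\infty\}$, and let $\Omega_{\rm per}$ be the set of $x\in\Omega_3$ that are not rest points and satisfy $\varphi_t(x)=x$ for some $t>0$. For $x\in\Omega_{\rm per}$ let $\mathfrak p(x)=\inf\{t>0:\varphi_t(x)=x\}$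 be the prime period; assume that for almost every $x\in\Omega_{\rm per}$ the function $s\mapsto\nu(\varphi_s(x))$ is integrable on $(0,\mathfrak p(x))$, and put $$\vartheta(x)=-\frac1{\mathfrak p(x)}\int_0^{\mathfrak p(x)}\nu(\varphi_s(x))\,ds,\qquad M_\lambda(x)=\exp\{-\mathfrak p(x)(\lambda-\vartheta(x))\}\quad(\lambda\in\mathbb C).$$ For $n\in\mathbb N$ let $\Omega_{{\rm per},n}=\{x\in\Omega_{\rm per}:\mathfrak p(x)\le n\}$, let $X_{{\rm per},n}$ be the space of $f\in L^p(\Omega,\mathfrak m)$ vanishing a.e. outside $\Omega_{{\rm per},n}$, and let $\mathcal T_{{\rm per},n}$ be the generator of the restriction of $(\mathcal U(t))_{t\ge0}$ to $X_{{\rm per},n}$, that is, $\mathcal T_{{\rm per},n}f=\lim_{t\to0^+}t^{-1}(\mathcal U(t)f-f)$ in $L^p$, with domain the set of those $f\in X_{{\rm per},n}$ for which the limit exists. **Theorem.** For every $n\in\mathbb N$, $$\sigma(\mathcal T_{{\rm per},n})\subset\{\lambda\in\mathbb C:\ 1\in\mathcal R_{\rm ess}(M_\lambda)\},$$ where $\mathcal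 R_{\rm ess}(M_\lambda)=\{z\in\mathbb C:\ \mathfrak m(\{x\in\Omega_{{\rm per},n}:|M_\lambda(x)-z|<\varepsilon\})>0\ \text{for all }\varepsilon>0\}$ is the essential range of $M_\lambda:\Omega_{{\rm per},n}\to\mathbb C$. -/

import Mathlib

open MeasureTheory Set Filter Topology
open scoped NNReal ENNReal

namespace PeriodicTransport

noncomputable section

/-- The phase space `ℝ^N` with its Euclidean norm. -/
abbrev E (N : ℕ) : Type := EuclideanSpace ℝ (Fin N)

/-- The flow `Φ(x, t)` of the field `F`: the value at time `t` of the global solution of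
`X' = F(X)`, `X(0) = x`. For a globally Lipschitz `F` this solution exists and is unique,
so that the `else` branch is never used. -/
def flow {N : ℕ} (F : E N → E N) (x : E N) (t : ℝ) : E N :=
  open Classical in
  if H : ∃ γ : ℝ → E N, γ 0 = x ∧ ∀ s : ℝ, HasDerivAt γ (F (γ s)) s then H.choose t else x

/-- Exit time `τ₊(x) = inf {s > 0 ; Φ(x, s) ∉ Ω}`, with `inf ∅ = ∞`. -/
def tauPlus {N : ℕ} (Ω : Set (E N)) (F : E N → E N) (x : E N) : EReal :=
  sInf ((fun s : ℝ => (s : EReal)) '' {s : ℝ | 0 < s ∧ flow F x s ∉ Ω})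

/-- Exit time `τ₋(x) = inf {s > 0 ; Φ(x, -s) ∉ Ω}`, with `inf ∅ = ∞`. -/
def tauMinus {N : ℕ} (Ω : Set (E N)) (F : E N → E N) (x : E N) : EReal :=
  sInf ((fun s : ℝ => (s : EReal)) '' {s : ℝ | 0 < s ∧ flow F x (-s) ∉ Ω})

/-- The divergence `∑ᵢ ∂ᵢ Fᵢ(x)` (defined at almost every point when `F` is Lipschitz). -/
def divergence {N : ℕ} (F : E N → E N) (x : E N) : ℝ :=
  ∑ i : Fin N, (fderiv ℝ F x (EuclideanSpace.single i 1)) i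

/-- `ν = h + div F`. -/
def nu {N : ℕ} (F : E N → E N) (h : E N → ℝ) (x : E N) : ℝ :=
  h x + divergence F x

/-- The weighted shift
`U(t) f (x) = exp (-∫₀ᵗ ν(Φ(x, -s)) ds) f(Φ(x, -t)) 1_{t < τ₋(x)}`, for `t ≥ 0`. -/
def weightedShift {N : ℕ} (Ω : Set (E N)) (F : E N → E N) (h : E N → ℝ)
    (t : ℝ) (f : E N → ℂ) (x : E N) : ℂ :=
  (Real.exp (-∫ s in (0 : ℝ)..t, nu F h (flow F x (-s))) : ℂ) * f (flow F x (-t)) *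
    {y : E N | (t : EReal) < tauMinus Ω F y}.indicator (fun _ => (1 : ℂ)) x

/-- `Ω₃`: the points of `Ω` whose whole orbit stays in `Ω`. -/
def omegaThree {N : ℕ} (Ω : Set (E N)) (F : E N → E N) : Set (E N) :=
  {x | x ∈ Ω ∧ tauPlus Ω F x = ⊤ ∧ tauMinus Ω F x = ⊤}

/-- The rest points of `φ_t = Φ(·, -t)`. -/
def omegaRest {N : ℕ} (Ω : Set (E N)) (F : E N → E N) : Set (E N) :=
  {x | x ∈ omegaThree Ω F ∧ ∀ t : ℝ, flow F x (-t) = x}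

/-- The points on (nonconstant) periodic orbits of `φ_t = Φ(·, -t)`. -/
def omegaPer {N : ℕ} (Ω : Set (E N)) (F : E N → E N) : Set (E N) :=
  {x | x ∈ omegaThree Ω F ∧ x ∉ omegaRest Ω F ∧ ∃ t : ℝ, 0 < t ∧ flow F x (-t) = x}

/-- The prime period `𝔭(x) = inf {t > 0 ; φ_t(x) = x}`. -/
def primePeriod {N : ℕ} (F : E N → E N) (x : E N) : ℝ :=
  sInf {t : ℝ | 0 < t ∧ flow F x (-t) = x}

/-- `Ω_{per,n}`: the periodic points with prime period at most `n`. -/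
def omegaPerN {N : ℕ} (Ω : Set (E N)) (F : E N → E N) (n : ℕ) : Set (E N) :=
  {x | x ∈ omegaPer Ω F ∧ primePeriod F x ≤ n}

/-- `ϑ(x) = -𝔭(x)⁻¹ ∫₀^{𝔭(x)} ν(φ_s(x)) ds`. -/
def vartheta {N : ℕ} (F : E N → E N) (h : E N → ℝ) (x : E N) : ℝ :=
  -(1 / primePeriod F x) * ∫ s in (0 : ℝ)..(primePeriod F x), nu F h (flow F x (-s))

/-- `M_λ(x) = exp (-𝔭(x) (λ - ϑ(x)))`. -/
def multiplier {N : ℕ} (F : E N → E N) (h : E N → ℝ) (lam : ℂ) (x : E N) : ℂ :=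
  Complex.exp (-(primePeriod F x : ℂ) * (lam - (vartheta F h x : ℂ)))

/-- The essential range of `g : A → ℂ` with respect to `μ`. -/
def essRangeOn {α : Type*} [MeasurableSpace α] (μ : Measure α) (A : Set α) (g : α → ℂ) : Set ℂ :=
  {z | ∀ ε : ℝ, 0 < ε → 0 < μ {x | x ∈ A ∧ ‖g x - z‖ < ε}}

/-- `X_{per,n}`: the functions of the complex space `L^p(Ω)` that vanish almost everywhere
outside `Ω_{per,n}`, with the norm of `L^p(Ω)`. -/
def XperN {N : ℕ} (Ω : Set (E N)) (F : E N → E N) (p : ℝ≥0∞) (n : ℕ) :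
    Submodule ℂ (Lp ℂ p ((volume : Measure (E N)).restrict Ω)) where
  carrier := {f | ∀ᵐ x ∂((volume : Measure (E N)).restrict Ω), x ∉ omegaPerN Ω F n → f x = 0}
  zero_mem' := by
    filter_upwards [Lp.coeFn_zero ℂ p ((volume : Measure (E N)).restrict Ω)] with x hx _
    simpa using hx
  add_mem' := by
    intro f g hf hg
    change ∀ᵐ x ∂((volume : Measure (E N)).restrict Ω), _
    rw [mem_ofPred_eq] at hf hg
    filter_upwards [Lp.coeFn_add f g, hf, hg] with x hx h1 h2 hxA
    rw [hx, Pi.add_apply, h1 hxA, h2 hxA, add_zero]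
  smul_mem' := by
    intro c f hf
    change ∀ᵐ x ∂((volume : Measure (E N)).restrict Ω), _
    rw [mem_ofPred_eq] at hf
    filter_upwards [Lp.coeFn_smul c f, hf] with x hx h1 hxA
    rw [hx, Pi.smul_apply, h1 hxA, smul_zero]

/-- The graph of the generator `T_{per,n}` of the restriction of `(U(t))` to `X_{per,n}`:
`f` is in the domain and `T_{per,n} f = g` when `(U(t) f - f) / t → g` in `L^p` as `t → 0⁺`. -/
def TperNGraph {N : ℕ} (Ω : Set (E N)) (F : E N → E N) (h : E N → ℝ) (p : ℝ≥0∞) (n : ℕ) :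
    Set (XperN Ω F p n × XperN Ω F p n) :=
  {fg | Tendsto
    (fun t : ℝ => eLpNorm
      (fun x => (weightedShift Ω F h t (fg.1 : Lp ℂ p (volume.restrict Ω)) x
          - (fg.1 : Lp ℂ p (volume.restrict Ω)) x) / (t : ℂ)
        - (fg.2 : Lp ℂ p (volume.restrict Ω)) x)
      p (volume.restrict Ω))
    (𝓝[>] 0) (𝓝 0)}

/-- The resolvent set of the operator with graph `G`: the `λ` for which `λ - T` maps the domain
bijectively onto `X`, with a bounded inverse `R`. -/
def resolventSetOfGraph {X : Type*} [NormedAddCommGroup X] [NormedSpace ℂ X] (G : Set (X × X)) :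
    Set ℂ :=
  {lam | ∃ R : X →L[ℂ] X,
    (∀ g : X, (R g, lam • R g - g) ∈ G) ∧ (∀ f g : X, (f, g) ∈ G → R (lam • f - g) = f)}

/-- The spectrum of the operator with graph `G`. -/
def spectrumOfGraph {X : Type*} [NormedAddCommGroup X] [NormedSpace ℂ X] (G : Set (X × X)) :
    Set ℂ :=
  (resolventSetOfGraph G)ᶜ

end

end PeriodicTransport

/-!
For `λ` with `1 ∉ R_ess(M_λ)` the resolvent of `T_{per,n}` is written down explicitly. With
`V(t) g = e^{-λ t} U(t) g`, one turn around the orbit of a periodic point `x` multiplies `V(t) g (x)`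
by `M_λ(x)`, so that summing the Laplace integral `∫₀^∞ V(s) g (x) ds` turn by turn as a geometric
series suggests
`R g (x) = (1 - M_λ(x))⁻¹ ∫₀^{𝔭(x)} V(s) g (x) ds`.
This expression makes sense as soon as `M_λ(x) ≠ 1`, whether or not the series converges.

* Boundedness (`PeriodicSystem.exists_eLpNorm_res_le`): `|1 - M_λ| ≥ ε` almost everywhere, the
  periods are at most `n`, and `V(s)` is bounded on `L^p` uniformly for `0 ≤ s ≤ n`. For the last
  point Liouville's formula is not needed: `div F` is bounded because `F` is Lipschitz, and the flow
  maps are Lipschitz, hence increase volumes by a bounded factor at most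
  (`exists_volume_preimage_flow_le`).
* Resolvent equation: along an orbit, both `V(t) R g` and `R V(t) g` equal `R g - ∫₀ᵗ V(s) g ds`
  (`PeriodicSystem.shift_res_ae`, `PeriodicSystem.res_shift_ae`), and `t⁻¹ ∫₀ᵗ V(s) g ds → g` in
  `L^p` (`PeriodicSystem.tendsto_average_shift`). The first identity shows that `R g` lies in the
  domain of `T` with `(λ - T) R g = g` (`PeriodicSystem.tendsto_generator_res`). The second one,
  divided by `t`, shows that `R (λ - T) f = f` for `f` in the domain
  (`PeriodicSystem.res_generator_ae`).

The set `Ω_{per,n}` is defined by a condition on whole orbits and need not be Borel.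
By `exists_carrier` it contains a Borel invariant set `B` that carries all functions
of `X_{per,n}`, and the computations take place on `L^p(B)`: start from a Borel set `K ⊆ Ω_{per,n}`
that contains every Borel subset of `Ω_{per,n}` up to a null set, pass to the points whose orbit spends a positive amount of time in `K`, and
remove the invariant null set where `ν` is not integrable over a period or `M_λ` is close to `1`.
-/

namespace PeriodicTransport

/-! ### The global flow of a Lipschitz field -/

section ODE

variable {V : Type*} [NormedAddCommGroup V] [NormedSpace ℝ V] {F : V → V} {κ : ℝ≥0}

/-- The length of the interval of existence does not depend on the initial point: on the ball of
radius `‖F x‖` around `x` the field is bounded by `(1 + κ) ‖F x‖`. -/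
lemma exists_solution_Ioo [CompleteSpace V] (hF : LipschitzWith κ F) (x : V) :
    ∃ γ : ℝ → V, γ 0 = x ∧
      ∀ t ∈ Ioo (-(1 / (1 + κ) : ℝ)) (1 / (1 + κ)), HasDerivAt γ (F (γ t)) t := by
  set T : ℝ := 1 / (1 + κ) with hT
  have hT0 : 0 < T := by positivity
  have hpl : IsPicardLindelof (fun _ => F) (tmin := -T) (tmax := T)
      ⟨0, by constructor <;> linarith⟩ x ‖F x‖₊ 0 ((1 + κ) * ‖F x‖₊) κ := by
    refine IsPicardLindelof.of_time_independent (fun y hy => ?_) hF.lipschitzOnWith ?_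
    · have h1 : ‖F y - F x‖ ≤ κ * ‖y - x‖ := by
        simpa [dist_eq_norm] using hF.dist_le_mul y x
      have h2 : ‖y - x‖ ≤ ‖F x‖ := by simpa [dist_eq_norm] using hy
      have h3 : ‖F y‖ ≤ ‖F y - F x‖ + ‖F x‖ := norm_le_norm_sub_add _ _
      have h4 : κ * ‖y - x‖ ≤ κ * ‖F x‖ := by gcongr
      push_cast
      linarith
    · simp only [sub_zero, zero_sub, neg_neg, max_self, NNReal.coe_mul, NNReal.coe_add,
        NNReal.coe_one, coe_nnnorm, NNReal.coe_zero, hT]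
      apply le_of_eq
      field_simp
  obtain ⟨γ, h0, hγ⟩ := hpl.exists_eq_forall_mem_Icc_hasDerivWithinAt₀
  exact ⟨γ, h0, fun t ht => (hγ t (Ioo_subset_Icc_self ht)).hasDerivAt (Icc_mem_nhds ht.1 ht.2)⟩

lemma solution_unique_Ioo (hF : LipschitzWith κ F) {a b t₀ : ℝ} (ht : t₀ ∈ Ioo a b) {f g : ℝ → V}
    (hf : ∀ t ∈ Ioo a b, HasDerivAt f (F (f t)) t) (hg : ∀ t ∈ Ioo a b, HasDerivAt g (F (g t)) t)
    (h0 : f t₀ = g t₀) : EqOn f g (Ioo a b) :=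
  ODE_solution_unique_of_mem_Ioo (v := fun _ => F) (s := fun _ => univ) (K := κ)
    (fun _ _ => hF.lipschitzOnWith) ht (fun t h => ⟨hf t h, mem_univ _⟩)
    (fun t h => ⟨hg t h, mem_univ _⟩) h0

/-- Solutions starting at `γ (b / 2)` and `γ (-b / 2)` prolong a solution on `(-b, b)`. -/
lemma exists_solution_Ioo_extend (hF : LipschitzWith κ F) {b : ℝ} (hb : 0 < b)
    (H : ∀ x : V, ∃ γ : ℝ → V, γ 0 = x ∧ ∀ t ∈ Ioo (-b) b, HasDerivAt γ (F (γ t)) t) (x : V) :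
    ∃ γ : ℝ → V, γ 0 = x ∧
      ∀ t ∈ Ioo (-(3 / 2 * b)) (3 / 2 * b), HasDerivAt γ (F (γ t)) t := by
  obtain ⟨γ, h0, hγ⟩ := H x
  obtain ⟨γ₁, h1, hγ₁⟩ := H (γ (b / 2))
  obtain ⟨γ₂, h2, hγ₂⟩ := H (γ (-(b / 2)))
  have e1 : ∀ t ∈ Ioo (-(b / 2)) b, γ t = γ₁ (t - b / 2) := by
    refine solution_unique_Ioo hF (t₀ := b / 2) ⟨by linarith, by linarith⟩
      (fun t ht => hγ t ⟨by linarith [ht.1], ht.2⟩) (fun t ht => ?_) (by simp [h1])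
    exact (hγ₁ (t - b / 2) ⟨by linarith [ht.1], by linarith [ht.2]⟩).comp_sub_const t (b / 2)
  have e2 : ∀ t ∈ Ioo (-b) (b / 2), γ t = γ₂ (t + b / 2) := by
    refine solution_unique_Ioo hF (t₀ := -(b / 2)) ⟨by linarith, by linarith⟩
      (fun t ht => hγ t ⟨ht.1, by linarith [ht.2]⟩) (fun t ht => ?_) (by simp [h2])
    exact (hγ₂ (t + b / 2) ⟨by linarith [ht.1], by linarith [ht.2]⟩).comp_add_const t (b / 2)
  set δ : ℝ → V := fun t =>
    if b / 2 < t then γ₁ (t - b / 2) else if t < -(b / 2) then γ₂ (t + b / 2) else γ t with hδ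
  have d0 : ∀ t ∈ Ioo (-b) b, δ t = γ t := by
    intro t ht
    simp only [hδ]
    split_ifs with c1 c2
    · exact (e1 t ⟨by linarith, ht.2⟩).symm
    · exact (e2 t ⟨ht.1, by linarith⟩).symm
    · rfl
  refine ⟨δ, by rw [d0 0 ⟨by linarith, hb⟩, h0], fun t ht => ?_⟩
  by_cases c1 : b / 2 < t
  · have : δ =ᶠ[𝓝 t] fun s => γ₁ (s - b / 2) := by
      filter_upwards [lt_mem_nhds c1] with s hs
      simp [hδ, hs]
    rw [this.eq_of_nhds]
    refine HasDerivAt.congr_of_eventuallyEq ?_ this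
    exact (hγ₁ (t - b / 2) ⟨by linarith [ht.1], by linarith [ht.2]⟩).comp_sub_const t (b / 2)
  by_cases c2 : t < -(b / 2)
  · have : δ =ᶠ[𝓝 t] fun s => γ₂ (s + b / 2) := by
      filter_upwards [gt_mem_nhds c2] with s hs
      simp [hδ, hs, show ¬ b / 2 < s by linarith]
    rw [this.eq_of_nhds]
    refine HasDerivAt.congr_of_eventuallyEq ?_ this
    exact (hγ₂ (t + b / 2) ⟨by linarith [ht.1], by linarith [ht.2]⟩).comp_add_const t (b / 2)
  · have hmem : t ∈ Ioo (-b) b := ⟨by linarith, by linarith⟩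
    have : δ =ᶠ[𝓝 t] γ := by
      filter_upwards [Ioo_mem_nhds hmem.1 hmem.2] with s hs using d0 s hs
    rw [this.eq_of_nhds]
    exact (hγ t hmem).congr_of_eventuallyEq this

lemma exists_solution [CompleteSpace V] (hF : LipschitzWith κ F) (x : V) :
    ∃ γ : ℝ → V, γ 0 = x ∧ ∀ t : ℝ, HasDerivAt γ (F (γ t)) t := by
  have hT0 : (0 : ℝ) < 1 / (1 + κ) := by positivity
  have hk : ∀ k : ℕ, ∃ γ : ℝ → V, γ 0 = x ∧
      ∀ t ∈ Ioo (-((3 / 2) ^ k * (1 / (1 + κ)) : ℝ)) ((3 / 2) ^ k * (1 / (1 + κ))),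
        HasDerivAt γ (F (γ t)) t := by
    intro k
    induction k generalizing x with
    | zero => simpa using exists_solution_Ioo hF x
    | succ k ih =>
      rw [pow_succ', mul_assoc]
      exact exists_solution_Ioo_extend hF (by positivity) ih x
  have hb : ∀ b : ℝ, ∃ γ : ℝ → V, γ 0 = x ∧ ∀ t ∈ Ioo (-b) b, HasDerivAt γ (F (γ t)) t := by
    intro b
    have hlim : Tendsto (fun k : ℕ => (3 / 2 : ℝ) ^ k * (1 / (1 + κ))) atTop atTop :=
      (tendsto_pow_atTop_atTop_of_one_lt (by norm_num)).atTop_mul_const hT0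
    obtain ⟨k, hkb⟩ := (hlim.eventually_ge_atTop b).exists
    obtain ⟨γ, h0, hγ⟩ := hk k
    exact ⟨γ, h0, fun t ht => hγ t ⟨by linarith [ht.1], by linarith [ht.2]⟩⟩
  choose γ h0 hγ using hb
  have key : ∀ a b : ℝ, 0 < a → a ≤ b → EqOn (γ a) (γ b) (Ioo (-a) a) := fun a b ha hab =>
    solution_unique_Ioo hF (t₀ := 0) ⟨by linarith, ha⟩ (hγ a)
      (fun t ht => hγ b t ⟨by linarith [ht.1], by linarith [ht.2]⟩) (by rw [h0, h0])
  refine ⟨fun t => γ (|t| + 1) t, h0 _, fun t => ?_⟩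
  have hev : (fun s => γ (|s| + 1) s) =ᶠ[𝓝 t] γ (|t| + 2) := by
    have : ∀ᶠ s in 𝓝 t, |s| < |t| + 1 :=
      continuous_abs.continuousAt.eventually_lt_const (by linarith)
    filter_upwards [this] with s hs
    exact key _ _ (by positivity) (by linarith)
      ⟨by linarith [neg_abs_le s], by linarith [le_abs_self s]⟩
  have := hγ (|t| + 2) t ⟨by linarith [neg_abs_le t], by linarith [le_abs_self t]⟩
  change HasDerivAt _ (F (γ (|t| + 1) t)) t
  rw [show γ (|t| + 1) t = γ (|t| + 2) t from hev.eq_of_nhds]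
  exact this.congr_of_eventuallyEq hev

end ODE

section Flow

variable {N : ℕ} {F : E N → E N} {κ : ℝ≥0}

lemma flow_spec (hF : LipschitzWith κ F) (x : E N) :
    flow F x 0 = x ∧ ∀ s : ℝ, HasDerivAt (flow F x) (F (flow F x s)) s := by
  have H := exists_solution hF x
  have : flow F x = H.choose := by
    funext t
    simp only [flow]
    rw [dif_pos H]
  rw [this]
  exact H.choose_spec

lemma flow_zero (hF : LipschitzWith κ F) (x : E N) : flow F x 0 = x := (flow_spec hF x).1

lemma flow_hasDerivAt (hF : LipschitzWith κ F) (x : E N) (s : ℝ) :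
    HasDerivAt (flow F x) (F (flow F x s)) s := (flow_spec hF x).2 s

lemma flow_flow (hF : LipschitzWith κ F) (x : E N) (s t : ℝ) :
    flow F (flow F x s) t = flow F x (t + s) := by
  refine congrFun (ODE_solution_unique_univ (v := fun _ => F) (s := fun _ => univ) (K := κ)
    (t₀ := 0) (f := flow F (flow F x s)) (g := fun t => flow F x (t + s))
    (fun _ => hF.lipschitzOnWith) (fun r => ⟨flow_hasDerivAt hF _ r, mem_univ _⟩)
    (fun r => ⟨?_, mem_univ _⟩) ?_) t
  · exact (flow_hasDerivAt hF x (r + s)).comp_add_const r s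
  · simp [flow_zero hF]

lemma dist_flow_le_of_nonneg (hF : LipschitzWith κ F) (x y : E N) {t : ℝ} (ht : 0 ≤ t) :
    dist (flow F x t) (flow F y t) ≤ dist x y * Real.exp (κ * t) := by
  have := dist_le_of_trajectories_ODE (v := fun _ => F) (K := κ) (a := 0) (b := t)
    (f := flow F x) (g := flow F y) (δ := dist x y) (fun _ => hF)
    (fun s _ => (flow_hasDerivAt hF x s).continuousAt.continuousWithinAt)
    (fun s _ => (flow_hasDerivAt hF x s).hasDerivWithinAt)
    (fun s _ => (flow_hasDerivAt hF y s).continuousAt.continuousWithinAt)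
    (fun s _ => (flow_hasDerivAt hF y s).hasDerivWithinAt)
    (by rw [flow_zero hF, flow_zero hF]) t ⟨ht, le_rfl⟩
  simpa using this

/-- Reversing time turns the flow of `F` into the flow of `-F`. -/
lemma flow_neg (hF : LipschitzWith κ F) (x : E N) (t : ℝ) :
    flow F x (-t) = flow (fun y => -F y) x t := by
  have hF' : LipschitzWith κ (fun y => -F y) := hF.neg
  refine congrFun (ODE_solution_unique_univ (v := fun _ y => -F y) (s := fun _ => univ) (K := κ)
    (t₀ := 0) (f := fun t => flow F x (-t)) (g := flow (fun y => -F y) x)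
    (fun _ => hF'.lipschitzOnWith) (fun r => ⟨?_, mem_univ _⟩)
    (fun r => ⟨flow_hasDerivAt hF' _ r, mem_univ _⟩) ?_) t
  · simpa [Function.comp_def] using (flow_hasDerivAt hF x (-r)).scomp r (hasDerivAt_neg r)
  · simp [flow_zero hF, flow_zero hF']

lemma dist_flow_le (hF : LipschitzWith κ F) (x y : E N) (t : ℝ) :
    dist (flow F x t) (flow F y t) ≤ dist x y * Real.exp (κ * |t|) := by
  rcases le_total 0 t with ht | ht
  · simpa [abs_of_nonneg ht] using dist_flow_le_of_nonneg hF x y ht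
  · have hF' : LipschitzWith κ (fun y => -F y) := hF.neg
    have := dist_flow_le_of_nonneg hF' x y (t := -t) (by linarith)
    rw [← flow_neg hF, ← flow_neg hF, neg_neg] at this
    simpa [abs_of_nonpos ht] using this

lemma lipschitzWith_flow (hF : LipschitzWith κ F) (t : ℝ) :
    LipschitzWith (Real.exp (κ * |t|)).toNNReal (fun x => flow F x t) :=
  LipschitzWith.of_dist_le_mul fun x y => by
    rw [Real.coe_toNNReal _ (Real.exp_pos _).le, mul_comm]
    exact dist_flow_le hF x y t

lemma continuous_flow (hF : LipschitzWith κ F) :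
    Continuous (fun z : E N × ℝ => flow F z.1 z.2) := by
  rw [continuous_iff_continuousAt]
  rintro ⟨x, t⟩
  rw [ContinuousAt, tendsto_iff_dist_tendsto_zero]
  have h1 : Tendsto (fun z : E N × ℝ => dist z.1 x * Real.exp (κ * |z.2|)
      + dist (flow F x z.2) (flow F x t)) (𝓝 (x, t)) (𝓝 0) := by
    have hc : Continuous (flow F x) :=
      continuous_iff_continuousAt.2 fun s => (flow_hasDerivAt hF x s).continuousAt
    have : Continuous (fun z : E N × ℝ => dist z.1 x * Real.exp (κ * |z.2|)
      + dist (flow F x z.2) (flow F x t)) := by fun_prop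
    simpa using this.tendsto (x, t)
  refine squeeze_zero (fun _ => dist_nonneg) (fun z => ?_) h1
  exact (dist_triangle _ (flow F x z.2) _).trans
    (add_le_add (dist_flow_le hF z.1 x z.2) le_rfl)

/-- The flow distorts volumes by a bounded factor on bounded time intervals: the preimage of `A`
is the image of `A` under a Lipschitz map. -/
lemma exists_volume_preimage_flow_le (hF : LipschitzWith κ F) (T : ℝ) :
    ∃ C : ℝ≥0∞, C ≠ ∞ ∧ ∀ t : ℝ, |t| ≤ T → ∀ A : Set (E N),
      volume ((fun x => flow F x t) ⁻¹' A) ≤ C * volume A := by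
  refine ⟨((Real.exp (κ * T)).toNNReal : ℝ≥0∞) ^ (Module.finrank ℝ (E N) : ℝ), ?_,
    fun t ht A => ?_⟩
  · exact ENNReal.rpow_ne_top_of_nonneg (by positivity) ENNReal.coe_ne_top
  have hL := lipschitzWith_flow hF (-t)
  have hL' : LipschitzWith (Real.exp (κ * T)).toNNReal (fun x => flow F x (-t)) := by
    refine hL.weaken (Real.toNNReal_le_toNNReal (Real.exp_le_exp.2 ?_))
    rw [abs_neg]; gcongr
  have himg : (fun x => flow F x t) ⁻¹' A = (fun x => flow F x (-t)) '' A := by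
    ext x
    constructor
    · intro hx
      exact ⟨flow F x t, hx, by simp [flow_flow hF, flow_zero hF]⟩
    · rintro ⟨y, hy, rfl⟩
      simpa [flow_flow hF, flow_zero hF] using hy
  have hvol := Measure.isAddLeftInvariant_eq_smul (volume : Measure (E N))
    (μH[(Module.finrank ℝ (E N) : ℝ)])
  rw [himg, hvol, Measure.smul_apply, Measure.smul_apply, ENNReal.smul_def, ENNReal.smul_def,
    smul_eq_mul, smul_eq_mul, mul_left_comm]
  gcongr
  exact hL'.hausdorffMeasure_image_le (by positivity) A

end Flow

/-! ### Preliminaries on parametrised integrals and `L^p` seminorms -/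

section Prelim

variable {α : Type*} [MeasurableSpace α]

lemma measurable_intervalIntegral_param {G : Type*} [NormedAddCommGroup G] [NormedSpace ℝ G]
    [MeasurableSpace G] [BorelSpace G] [SecondCountableTopology G]
    {f : α × ℝ → G} (hf : Measurable f) {a b : α → ℝ} (ha : Measurable a) (hb : Measurable b) :
    Measurable (fun x => ∫ s in (a x)..(b x), f (x, s)) := by
  have key : ∀ a b : α → ℝ, Measurable a → Measurable b →
      Measurable (fun x => ∫ s in Ioc (a x) (b x), f (x, s)) := by
    intro a b ha hb
    have hS : MeasurableSet {z : α × ℝ | z.2 ∈ Ioc (a z.1) (b z.1)} :=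
      (measurableSet_lt (ha.comp measurable_fst) measurable_snd).inter
        (measurableSet_le measurable_snd (hb.comp measurable_fst))
    have h1 : StronglyMeasurable ({z : α × ℝ | z.2 ∈ Ioc (a z.1) (b z.1)}.indicator f) :=
      (hf.indicator hS).stronglyMeasurable
    have h2 := (h1.integral_prod_right' (ν := (volume : Measure ℝ))).measurable
    convert! h2 using 2 with x
    rw [← integral_indicator measurableSet_Ioc]
    rfl
  simp only [intervalIntegral]
  exact (key a b ha hb).sub (key b a hb ha)

variable {μ : Measure α} {p : ℝ≥0∞}

/-- Minkowski's integral inequality in the form needed here: averaging over `s` does not increase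
a uniform bound for the `L^p` norms. -/
lemma eLpNorm_lintegral_Ioc_le [SFinite μ] (hp1 : 1 ≤ p) (hp : p ≠ ∞) {k : α → ℝ → ℝ≥0∞}
    (hk : Measurable (fun z : α × ℝ => k z.1 z.2)) {t : ℝ} {D : ℝ≥0∞}
    (hD : ∀ s ∈ Ioc 0 t, eLpNorm (fun x => k x s) p μ ≤ D) :
    eLpNorm (fun x => ∫⁻ s in Ioc 0 t, k x s) p μ ≤ ENNReal.ofReal t * D := by
  have hp0 : p ≠ 0 := (zero_lt_one.trans_le hp1).ne'
  set r := p.toReal with hr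
  have hr1 : 1 ≤ r := by
    rw [hr, ← ENNReal.toReal_one]; exact ENNReal.toReal_mono hp hp1
  have hr0 : 0 < r := by linarith
  have hvol : (volume.restrict (Ioc 0 t) : Measure ℝ) univ = ENNReal.ofReal t := by simp
  have hmeasx : ∀ x, Measurable (fun s => k x s) := fun x => hk.comp measurable_prodMk_left
  have hD' : ∀ s ∈ Ioc 0 t, ∫⁻ x, k x s ^ r ∂μ ≤ D ^ r := by
    intro s hs
    have := hD s hs
    rw [eLpNorm_eq_lintegral_rpow_enorm_toReal hp0 hp] at this
    simp only [enorm_eq_self, one_div] at this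
    rwa [ENNReal.rpow_inv_le_iff hr0] at this
  -- Hölder's inequality on `(0, t]` for a fixed `x`
  have hH : ∀ x, (∫⁻ s in Ioc 0 t, k x s) ^ r
      ≤ (∫⁻ s in Ioc 0 t, k x s ^ r) * ENNReal.ofReal t ^ (r - 1) := by
    intro x
    have := eLpNorm'_le_eLpNorm'_mul_rpow_measure_univ (μ := volume.restrict (Ioc 0 t))
      (f := fun s => k x s) zero_lt_one hr1 (hmeasx x).aestronglyMeasurable
    simp only [eLpNorm', enorm_eq_self, ENNReal.rpow_one, div_one, hvol] at this
    have h2 := ENNReal.rpow_le_rpow this hr0.le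
    rw [ENNReal.mul_rpow_of_nonneg _ _ hr0.le, ← ENNReal.rpow_mul, ← ENNReal.rpow_mul,
      one_div, inv_mul_cancel₀ hr0.ne', ENNReal.rpow_one] at h2
    rwa [show (1 - r⁻¹) * r = r - 1 by field_simp] at h2
  rw [eLpNorm_eq_lintegral_rpow_enorm_toReal hp0 hp, one_div, ENNReal.rpow_inv_le_iff hr0]
  simp only [enorm_eq_self]
  calc ∫⁻ x, (∫⁻ s in Ioc 0 t, k x s) ^ r ∂μ
      ≤ ∫⁻ x, (∫⁻ s in Ioc 0 t, k x s ^ r) * ENNReal.ofReal t ^ (r - 1) ∂μ := lintegral_mono hH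
    _ = (∫⁻ x, (∫⁻ s in Ioc 0 t, k x s ^ r) ∂μ) * ENNReal.ofReal t ^ (r - 1) :=
        lintegral_mul_const _ (Measurable.lintegral_prod_right' (f := fun z : α × ℝ => k z.1 z.2 ^ r)
          (hk.pow_const r))
    _ = (∫⁻ s in Ioc 0 t, ∫⁻ x, k x s ^ r ∂μ) * ENNReal.ofReal t ^ (r - 1) := by
        rw [lintegral_lintegral_swap]
        exact (hk.pow_const r).aemeasurable
    _ ≤ (∫⁻ _ in Ioc 0 t, D ^ r) * ENNReal.ofReal t ^ (r - 1) := by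
        gcongr ?_ * _
        exact setLIntegral_mono measurable_const hD'
    _ = (ENNReal.ofReal t * D) ^ r := by
        rw [lintegral_const, hvol, ENNReal.mul_rpow_of_nonneg _ _ hr0.le, mul_assoc, mul_comm]
        congr 1
        conv_rhs => rw [show r = 1 + (r - 1) by ring]
        rw [ENNReal.rpow_add_of_nonneg _ _ zero_le_one (by linarith), ENNReal.rpow_one]

lemma eLpNorm_comp_le_of_preimage_le (hp : p ≠ ∞) {τ : α → α} (hτ : Measurable τ) {C : ℝ≥0∞}
    (hC : ∀ A : Set α, MeasurableSet A → μ (τ ⁻¹' A) ≤ C * μ A) {g : α → ℂ} (hg : Measurable g) :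
    eLpNorm (fun x => g (τ x)) p μ ≤ C ^ (1 / p).toReal * eLpNorm g p μ := by
  have h2 : eLpNorm (fun x => g (τ x)) p μ = eLpNorm g p (μ.map τ) :=
    (eLpNorm_map_measure hg.aestronglyMeasurable hτ.aemeasurable).symm
  have h3 : μ.map τ ≤ C • μ := by
    refine Measure.le_iff.2 fun A hA => ?_
    rw [Measure.map_apply hτ hA]
    exact hC A hA
  rw [h2]
  exact (eLpNorm_mono_measure g h3).trans_eq (eLpNorm_smul_measure_of_ne_top hp g C)

lemma tendsto_eLpNorm_add_zero {ι : Type*} {l : Filter ι} (hp1 : 1 ≤ p) {f g : ι → α → ℂ}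
    (hfm : ∀ i, Measurable (f i)) (hgm : ∀ i, Measurable (g i))
    (hf : Tendsto (fun i => eLpNorm (f i) p μ) l (𝓝 0))
    (hg : Tendsto (fun i => eLpNorm (g i) p μ) l (𝓝 0)) :
    Tendsto (fun i => eLpNorm (fun x => f i x + g i x) p μ) l (𝓝 0) := by
  have := hf.add hg
  rw [add_zero] at this
  exact tendsto_of_tendsto_of_tendsto_of_le_of_le tendsto_const_nhds this (fun _ => zero_le)
    fun i => eLpNorm_add_le (hfm i).aestronglyMeasurable (hgm i).aestronglyMeasurable hp1

lemma tendsto_eLpNorm_mul_zero {ι : Type*} {l : Filter ι} {f : ι → α → ℂ} {c : ι → ℂ} {c₀ : ℂ}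
    (hc : Tendsto c l (𝓝 c₀)) (hf : Tendsto (fun i => eLpNorm (f i) p μ) l (𝓝 0)) :
    Tendsto (fun i => eLpNorm (fun x => c i * f i x) p μ) l (𝓝 0) := by
  have h1 : ∀ i, eLpNorm (fun x => c i * f i x) p μ = ‖c i‖ₑ * eLpNorm (f i) p μ := fun i =>
    eLpNorm_const_smul (c i) (f i) p μ
  simp_rw [h1]
  have := ENNReal.Tendsto.mul hc.enorm (Or.inr ENNReal.zero_ne_top) hf (Or.inr enorm_ne_top)
  simpa using this

lemma tendsto_eLpNorm_mul_const_zero {ι : Type*} {l : Filter ι} {f : α → ℂ} {c : ι → ℂ}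
    (hc : Tendsto c l (𝓝 0)) (hf : eLpNorm f p μ ≠ ∞) :
    Tendsto (fun i => eLpNorm (fun x => c i * f x) p μ) l (𝓝 0) := by
  have h1 : ∀ i, eLpNorm (fun x => c i * f x) p μ = ‖c i‖ₑ * eLpNorm f p μ := fun i =>
    eLpNorm_const_smul (c i) f p μ
  simp_rw [h1]
  have := ENNReal.Tendsto.mul_const hc.enorm (Or.inr hf) (b := eLpNorm f p μ)
  simpa using this

end Prelim

/-! ### Weighted shifts along a periodic measurable flow -/

/-- A measurable flow `φ` on `(α, μ)`, carried by an invariant set `carrier` of periodic points of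
period `per ≤ T`, with a weight `ν` that is bounded below and locally integrable along the orbits.
The flow distorts `μ` by a bounded factor on bounded time intervals, and it acts strongly
continuously on `L^p(μ)`. The period and the lower bound are asked for on `carrier` only. -/
structure PeriodicSystem {α : Type*} [MeasurableSpace α] (μ : Measure α) (p : ℝ≥0∞) where
  φ : α → ℝ → α
  ν : α → ℝ
  per : α → ℝ
  carrier : Set α
  T : ℝ
  c : ℝ
  measurable_φ : Measurable (fun z : α × ℝ => φ z.1 z.2)
  measurable_ν : Measurable ν
  measurable_per : Measurable per
  φ_φ : ∀ x s t, φ (φ x s) t = φ x (s + t)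
  ae_mem : ∀ᵐ x ∂μ, x ∈ carrier
  φ_mem : ∀ x ∈ carrier, ∀ s, φ x s ∈ carrier
  per_pos : ∀ x ∈ carrier, 0 < per x
  per_le : ∀ x ∈ carrier, per x ≤ T
  φ_per : ∀ x ∈ carrier, φ x (per x) = x
  per_φ : ∀ x ∈ carrier, ∀ s, per (φ x s) = per x
  integrable_ν : ∀ x ∈ carrier, ∀ a b, IntervalIntegrable (fun s => ν (φ x s)) volume a b
  le_ν : ∀ x ∈ carrier, c ≤ ν x
  preimage_le : ∀ t : ℝ, ∃ C : ℝ≥0∞, C ≠ ∞ ∧ ∀ s ∈ Icc 0 t, ∀ A : Set α, MeasurableSet A →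
    μ ((fun x => φ x s) ⁻¹' A) ≤ C * μ A
  tendsto_φ : ∀ g : α → ℂ, Measurable g → eLpNorm g p μ ≠ ∞ →
    Tendsto (fun s => eLpNorm (fun x => g (φ x s) - g x) p μ) (𝓝[>] (0 : ℝ)) (𝓝 0)

namespace PeriodicSystem

variable {α : Type*} [MeasurableSpace α] {μ : Measure α} {p : ℝ≥0∞} (S : PeriodicSystem μ p)
  (lam : ℂ)

/-- The cocycle `exp (-λ t - ∫₀ᵗ ν(φ_s x) ds)`. -/
noncomputable def weight (x : α) (t : ℝ) : ℂ :=
  Complex.exp (-(lam * t) - ((∫ s in (0 : ℝ)..t, S.ν (S.φ x s) : ℝ) : ℂ))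

/-- The multiplier picked up in one turn around the orbit of `x`. -/
noncomputable def mult (x : α) : ℂ := S.weight lam x (S.per x)

/-- The rescaled weighted shift `e^{-λ t} U(t) g`. -/
noncomputable def shift (t : ℝ) (g : α → ℂ) (x : α) : ℂ := S.weight lam x t * g (S.φ x t)

/-- The candidate for `(λ - T)⁻¹ g`: formally the Laplace integral `∫₀^∞ e^{-λ s} U(s) g(x) ds`,
in which the contributions of the successive turns form a geometric series of ratio
`mult x`. -/
noncomputable def res (g : α → ℂ) (x : α) : ℂ :=
  (1 - S.mult lam x)⁻¹ * ∫ s in (0 : ℝ)..(S.per x), S.shift lam s g x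

/-! ### Pointwise identities along an orbit -/

lemma weight_zero (x : α) : S.weight lam x 0 = 1 := by simp [weight]

lemma weight_ne_zero (x : α) (t : ℝ) : S.weight lam x t ≠ 0 := Complex.exp_ne_zero _

variable {S} in
lemma weight_add {x : α} (hx : x ∈ S.carrier) (s t : ℝ) :
    S.weight lam x (s + t) = S.weight lam x s * S.weight lam (S.φ x s) t := by
  simp only [weight]
  rw [← Complex.exp_add]
  congr 1
  have h1 : ∫ r in (0 : ℝ)..t, S.ν (S.φ (S.φ x s) r) = ∫ r in s..(s + t), S.ν (S.φ x r) := by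
    simp_rw [S.φ_φ]
    rw [intervalIntegral.integral_comp_add_left (fun r => S.ν (S.φ x r)) s, add_zero]
  rw [h1, ← intervalIntegral.integral_add_adjacent_intervals (S.integrable_ν x hx 0 s)
    (S.integrable_ν x hx s (s + t))]
  push_cast
  ring

variable {S} in
lemma weight_add_per {x : α} (hx : x ∈ S.carrier) (s : ℝ) :
    S.weight lam x (S.per x + s) = S.mult lam x * S.weight lam x s := by
  rw [weight_add lam hx, S.φ_per x hx, mult]

variable {S} in
lemma mult_φ {x : α} (hx : x ∈ S.carrier) (s : ℝ) : S.mult lam (S.φ x s) = S.mult lam x := by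
  have h1 := weight_add_per lam hx s
  have h2 := weight_add lam hx s (S.per x)
  rw [add_comm, h1, mul_comm] at h2
  rw [mult, S.per_φ x hx]
  exact (mul_left_cancel₀ (S.weight_ne_zero lam x s) h2).symm

variable {S} in
lemma norm_weight_le {x : α} (hx : x ∈ S.carrier) {t t' : ℝ} (ht : 0 ≤ t) (htt : t ≤ t') :
    ‖S.weight lam x t‖ ≤ Real.exp ((‖lam‖ + |S.c|) * t') := by
  rw [weight, Complex.norm_exp, Real.exp_le_exp]
  simp only [Complex.sub_re, Complex.neg_re, Complex.mul_re, Complex.ofReal_re, Complex.ofReal_im,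
    mul_zero, sub_zero]
  have h1 : S.c * t ≤ ∫ s in (0 : ℝ)..t, S.ν (S.φ x s) := by
    have := intervalIntegral.integral_mono_on ht (intervalIntegrable_const (c := S.c) (μ := volume))
      (S.integrable_ν x hx 0 t) (fun s _ => S.le_ν _ (S.φ_mem x hx s))
    simpa [mul_comm] using this
  have h2 : -(lam.re * t) ≤ ‖lam‖ * t := by
    nlinarith [neg_abs_le lam.re, Complex.abs_re_le_norm lam]
  have h3 : -(S.c * t) ≤ |S.c| * t := by nlinarith [neg_abs_le S.c]
  have h4 : (‖lam‖ + |S.c|) * t ≤ (‖lam‖ + |S.c|) * t' := by gcongr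
  linarith

variable {S} in
lemma continuous_weight {x : α} (hx : x ∈ S.carrier) : Continuous (S.weight lam x) := by
  have h := intervalIntegral.continuous_primitive (fun a b => S.integrable_ν x hx a b) 0
  unfold weight
  fun_prop

variable {S} in
lemma shift_shift {x : α} (hx : x ∈ S.carrier) (s t : ℝ) (g : α → ℂ) :
    S.shift lam s (S.shift lam t g) x = S.shift lam (s + t) g x := by
  simp only [shift]
  rw [weight_add lam hx, S.φ_φ, mul_assoc]

variable {S} in
lemma shift_add_per {x : α} (hx : x ∈ S.carrier) (s : ℝ) (g : α → ℂ) :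
    S.shift lam (s + S.per x) g x = S.mult lam x * S.shift lam s g x := by
  simp only [shift]
  rw [add_comm s, weight_add_per lam hx, ← S.φ_φ, S.φ_per x hx, mul_assoc]

variable {S} in
lemma res_shift_eq {x : α} (hx : x ∈ S.carrier) (t : ℝ) (g : α → ℂ) :
    S.res lam (S.shift lam t g) x
      = (1 - S.mult lam x)⁻¹ * ∫ s in t..(t + S.per x), S.shift lam s g x := by
  simp only [res]
  simp_rw [shift_shift lam hx]
  rw [intervalIntegral.integral_comp_add_right (fun s => S.shift lam s g x) t, zero_add,
    add_comm (S.per x)]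

variable {S} in
lemma shift_res_eq {x : α} (hx : x ∈ S.carrier) (t : ℝ) (g : α → ℂ) :
    S.shift lam t (S.res lam g) x
      = (1 - S.mult lam x)⁻¹ * ∫ s in t..(t + S.per x), S.shift lam s g x := by
  conv_lhs => rw [shift, res]
  rw [mult_φ lam hx, S.per_φ x hx, mul_left_comm, ← intervalIntegral.integral_const_mul]
  congr 1
  have : ∀ s, S.weight lam x t * S.shift lam s g (S.φ x t) = S.shift lam (t + s) g x := fun s =>
    shift_shift lam hx t s g
  simp_rw [this]
  rw [intervalIntegral.integral_comp_add_left (fun s => S.shift lam s g x) t, add_zero]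

variable {S} in
/-- A turn started at time `t` differs from the turn started at time `0` by the factor
`1 - mult x` times the integral over `(0, t)`, which the prefactor of `res` cancels. -/
lemma integral_turn_eq {x : α} (hx : x ∈ S.carrier) (hm : S.mult lam x ≠ 1) (t : ℝ) (g : α → ℂ)
    (ht : 0 ≤ t)
    (hi : ∀ a b, 0 ≤ a → 0 ≤ b → IntervalIntegrable (fun s => S.shift lam s g x) volume a b) :
    (1 - S.mult lam x)⁻¹ * ∫ s in t..(t + S.per x), S.shift lam s g x
      = S.res lam g x - ∫ s in (0 : ℝ)..t, S.shift lam s g x := by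
  have hp := S.per_pos x hx
  have h1 : ∫ s in (S.per x)..(t + S.per x), S.shift lam s g x
      = S.mult lam x * ∫ s in (0 : ℝ)..t, S.shift lam s g x := by
    rw [← intervalIntegral.integral_const_mul]
    simp_rw [← shift_add_per lam hx]
    rw [intervalIntegral.integral_comp_add_right (fun s => S.shift lam s g x) (S.per x), zero_add]
  have h2 := intervalIntegral.integral_add_adjacent_intervals (hi 0 t le_rfl ht)
    (hi t (t + S.per x) ht (by linarith))
  have h3 := intervalIntegral.integral_add_adjacent_intervals (hi 0 (S.per x) le_rfl hp.le)
    (hi (S.per x) (t + S.per x) hp.le (by linarith))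
  rw [h1] at h3
  have hne : (1 - S.mult lam x) ≠ 0 := sub_ne_zero.2 hm.symm
  rw [res, eq_sub_iff_add_eq]
  field_simp
  linear_combination h2 - h3

/-! ### Measurability and bounds -/

lemma measurable_weight : Measurable (fun z : α × ℝ => S.weight lam z.1 z.2) := by
  have h0 : Measurable (fun w : (α × ℝ) × ℝ => S.ν (S.φ w.1.1 w.2)) :=
    S.measurable_ν.comp (S.measurable_φ.comp (f := fun w : (α × ℝ) × ℝ => (w.1.1, w.2))
      ((measurable_fst.comp measurable_fst).prodMk measurable_snd))
  have h1 : Measurable (fun z : α × ℝ => ∫ s in (0 : ℝ)..z.2, S.ν (S.φ z.1 s)) :=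
    measurable_intervalIntegral_param h0 (a := fun _ => 0) (b := fun z => z.2)
      measurable_const measurable_snd
  have h2 : Measurable (fun z : α × ℝ => -(lam * (z.2 : ℂ))) :=
    (measurable_const.mul (Complex.measurable_ofReal.comp measurable_snd)).neg
  exact Complex.measurable_exp.comp (h2.sub (Complex.measurable_ofReal.comp h1))

variable {S lam} in
lemma measurable_shift_uncurry {g : α → ℂ} (hg : Measurable g) :
    Measurable (fun z : α × ℝ => S.shift lam z.2 g z.1) :=
  (S.measurable_weight lam).mul (hg.comp S.measurable_φ)

variable {S lam} in
lemma measurable_shift {g : α → ℂ} (hg : Measurable g) (t : ℝ) : Measurable (S.shift lam t g) := by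
  have h := (measurable_shift_uncurry (S := S) (lam := lam) hg).comp
    (measurable_prodMk_right (y := t))
  exact h

lemma measurable_φ_apply (t : ℝ) : Measurable (fun x => S.φ x t) :=
  S.measurable_φ.comp (measurable_prodMk_right (y := t))

lemma measurable_mult : Measurable (S.mult lam) :=
  (S.measurable_weight lam).comp (measurable_id.prodMk S.measurable_per)

variable {S lam} in
lemma measurable_integral_shift {g : α → ℂ} (hg : Measurable g) (t : ℝ) :
    Measurable (fun x => ∫ s in (0 : ℝ)..t, S.shift lam s g x) :=
  measurable_intervalIntegral_param (measurable_shift_uncurry hg) measurable_const measurable_const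

variable {S lam} in
lemma measurable_res {g : α → ℂ} (hg : Measurable g) : Measurable (S.res lam g) :=
  (measurable_const.sub (S.measurable_mult lam)).inv.mul
    (measurable_intervalIntegral_param (measurable_shift_uncurry hg) measurable_const
      S.measurable_per)

lemma exists_eLpNorm_shift_le (hp : p ≠ ∞) (t : ℝ) :
    ∃ K : ℝ≥0∞, K ≠ ∞ ∧ ∀ s ∈ Icc 0 t, ∀ g : α → ℂ, Measurable g →
      eLpNorm (S.shift lam s g) p μ ≤ K * eLpNorm g p μ := by
  obtain ⟨C, hC, hCle⟩ := S.preimage_le t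
  set M := Real.exp ((‖lam‖ + |S.c|) * t) with hM
  refine ⟨ENNReal.ofReal M * C ^ (1 / p).toReal, ENNReal.mul_ne_top ENNReal.ofReal_ne_top
    (ENNReal.rpow_ne_top_of_nonneg ENNReal.toReal_nonneg hC), fun s hs g hg => ?_⟩
  have h1 : eLpNorm (S.shift lam s g) p μ
      ≤ ENNReal.ofReal M * eLpNorm (fun x => g (S.φ x s)) p μ := by
    refine eLpNorm_le_mul_eLpNorm_of_ae_le_mul ?_ p
    filter_upwards [S.ae_mem] with x hx
    rw [shift, norm_mul]
    gcongr
    exact norm_weight_le lam hx hs.1 hs.2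
  rw [mul_assoc]
  refine h1.trans ?_
  gcongr
  exact eLpNorm_comp_le_of_preimage_le hp (S.measurable_φ_apply s) (hCle s hs) hg

/-- `μ`-null sets are not charged by almost all orbit segments. -/
lemma ae_ae_φ [SFinite μ] {P : α → Prop} (h : ∀ᵐ x ∂μ, P x) (t : ℝ) :
    ∀ᵐ x ∂μ, ∀ᵐ s ∂(volume.restrict (Ioc 0 t)), P (S.φ x s) := by
  obtain ⟨D, hPD, hD, hD0⟩ := exists_measurable_superset_of_null h
  obtain ⟨C, hC, hCle⟩ := S.preimage_le t
  have hmeas : MeasurableSet {z : α × ℝ | S.φ z.1 z.2 ∈ D} := S.measurable_φ hD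
  have h0 : (μ.prod (volume.restrict (Ioc 0 t))) {z : α × ℝ | S.φ z.1 z.2 ∈ D} = 0 := by
    rw [Measure.prod_apply_symm hmeas, lintegral_eq_zero_iff (measurable_measure_prodMk_right hmeas)]
    filter_upwards [ae_restrict_mem measurableSet_Ioc] with s hs
    have := hCle s ⟨hs.1.le, hs.2⟩ D hD
    rw [hD0, mul_zero] at this
    exact le_antisymm this zero_le
  have := Measure.ae_ae_of_ae_prod (p := fun z : α × ℝ => S.φ z.1 z.2 ∉ D)
    (by rw [ae_iff]; simpa using h0)
  filter_upwards [this] with x hx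
  filter_upwards [hx] with s hs
  by_contra hP
  exact hs (hPD hP)

lemma ae_comp_φ {P : α → Prop} (h : ∀ᵐ x ∂μ, P x) {t : ℝ} (ht : 0 ≤ t) :
    ∀ᵐ x ∂μ, P (S.φ x t) := by
  obtain ⟨D, hPD, hD, hD0⟩ := exists_measurable_superset_of_null h
  obtain ⟨C, hC, hCle⟩ := S.preimage_le t
  have := hCle t ⟨ht, le_rfl⟩ D hD
  rw [hD0, mul_zero] at this
  have h0 : ∀ᵐ x ∂μ, S.φ x t ∉ D := by
    rw [ae_iff]; simpa using! le_antisymm this zero_le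
  filter_upwards [h0] with x hx
  by_contra hP
  exact hx (hPD hP)

lemma shift_congr_ae {f g : α → ℂ} (h : f =ᵐ[μ] g) {t : ℝ} (ht : 0 ≤ t) :
    S.shift lam t f =ᵐ[μ] S.shift lam t g := by
  filter_upwards [S.ae_comp_φ h ht] with x hx
  rw [shift, shift, hx]

lemma res_congr_ae [SFinite μ] {f g : α → ℂ} (h : f =ᵐ[μ] g) :
    S.res lam f =ᵐ[μ] S.res lam g := by
  filter_upwards [S.ae_ae_φ h S.T, S.ae_mem] with x hx hxc
  rw [res, res]
  congr 1
  refine intervalIntegral.integral_congr_ae_restrict ?_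
  rw [uIoc_of_le (S.per_pos x hxc).le]
  filter_upwards [ae_restrict_of_ae_restrict_of_subset (Ioc_subset_Ioc_right (S.per_le x hxc)) hx]
    with s hs
  rw [shift, shift, hs]

variable [SFinite μ] (hp1 : 1 ≤ p) (hp : p ≠ ∞)

include hp1 hp

lemma exists_eLpNorm_lintegral_shift_le (t : ℝ) :
    ∃ K : ℝ≥0∞, K ≠ ∞ ∧ ∀ g : α → ℂ, Measurable g →
      eLpNorm (fun x => ∫⁻ s in Ioc 0 t, ‖S.shift lam s g x‖ₑ) p μ ≤ K * eLpNorm g p μ := by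
  obtain ⟨K, hK, hKle⟩ := S.exists_eLpNorm_shift_le lam hp t
  refine ⟨ENNReal.ofReal t * K, ENNReal.mul_ne_top ENNReal.ofReal_ne_top hK, fun g hg => ?_⟩
  rw [mul_assoc]
  refine eLpNorm_lintegral_Ioc_le hp1 hp (measurable_shift_uncurry hg).enorm fun s hs => ?_
  rw [eLpNorm_enorm]
  exact hKle s ⟨hs.1.le, hs.2⟩ g hg

lemma ae_intervalIntegrable_shift {g : α → ℂ} (hg : Measurable g) (hgp : eLpNorm g p μ ≠ ∞) :
    ∀ᵐ x ∂μ, ∀ a b, 0 ≤ a → 0 ≤ b →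
      IntervalIntegrable (fun s => S.shift lam s g x) volume a b := by
  have hp0 : p ≠ 0 := (zero_lt_one.trans_le hp1).ne'
  have hr0 : 0 < p.toReal := ENNReal.toReal_pos hp0 hp
  have key : ∀ t : ℕ, ∀ᵐ x ∂μ, IntegrableOn (fun s => S.shift lam s g x) (Ioc 0 (t : ℝ)) := by
    intro t
    obtain ⟨K, hK, hKle⟩ := S.exists_eLpNorm_lintegral_shift_le lam hp1 hp t
    have hfin : eLpNorm (fun x => ∫⁻ s in Ioc 0 (t : ℝ), ‖S.shift lam s g x‖ₑ) p μ < ∞ :=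
      (hKle g hg).trans_lt (ENNReal.mul_lt_top hK.lt_top hgp.lt_top)
    rw [eLpNorm_lt_top_iff_lintegral_rpow_enorm_lt_top hp0 hp] at hfin
    simp only [enorm_eq_self] at hfin
    have hm : Measurable fun x => ∫⁻ s in Ioc 0 (t : ℝ), ‖S.shift lam s g x‖ₑ :=
      Measurable.lintegral_prod_right' (f := fun z : α × ℝ => ‖S.shift lam z.2 g z.1‖ₑ)
        (measurable_shift_uncurry hg).enorm
    filter_upwards [ae_lt_top (hm.pow_const _) hfin.ne] with x hx
    refine ⟨((measurable_shift_uncurry hg).comp measurable_prodMk_left).aestronglyMeasurable, ?_⟩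
    rw [hasFiniteIntegral_iff_enorm]
    exact (ENNReal.rpow_lt_top_iff_of_pos hr0).1 hx
  filter_upwards [ae_all_iff.2 key] with x hx
  have h0 : ∀ a, 0 ≤ a → IntervalIntegrable (fun s => S.shift lam s g x) volume 0 a := by
    intro a ha
    obtain ⟨k, hk⟩ := exists_nat_ge a
    rw [intervalIntegrable_iff_integrableOn_Ioc_of_le ha]
    exact (hx k).mono_set (Ioc_subset_Ioc_right hk)
  exact fun a b ha hb => (h0 a ha).symm.trans (h0 b hb)

/-- The gap `|1 - mult| ≥ ε` makes the candidate resolvent bounded on `L^p(μ)`. -/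
lemma exists_eLpNorm_res_le {ε : ℝ} (hε : 0 < ε)
    (hgap : ∀ x ∈ S.carrier, ε ≤ ‖1 - S.mult lam x‖) :
    ∃ K : ℝ≥0∞, K ≠ ∞ ∧ ∀ g : α → ℂ, Measurable g →
      eLpNorm (S.res lam g) p μ ≤ K * eLpNorm g p μ := by
  obtain ⟨K, hK, hKle⟩ := S.exists_eLpNorm_lintegral_shift_le lam hp1 hp S.T
  refine ⟨(ENNReal.ofReal ε)⁻¹ * K, ENNReal.mul_ne_top (by simpa using hε) hK, fun g hg => ?_⟩
  set k : α → ℝ≥0∞ := fun x => ∫⁻ s in Ioc 0 S.T, ‖S.shift lam s g x‖ₑ with hk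
  have hm : Measurable k :=
    Measurable.lintegral_prod_right' (f := fun z : α × ℝ => ‖S.shift lam z.2 g z.1‖ₑ)
      (measurable_shift_uncurry hg).enorm
  have h1 : ∀ᵐ x ∂μ, ‖S.res lam g x‖ₑ ≤ ‖(ENNReal.ofReal ε)⁻¹ * k x‖ₑ := by
    filter_upwards [S.ae_mem] with x hx
    rw [res, enorm_mul, enorm_eq_self]
    have hne : (1 - S.mult lam x) ≠ 0 := by
      intro h0
      have := hgap x hx
      rw [h0, norm_zero] at this
      linarith
    gcongr ?_ * ?_
    · rw [enorm_inv hne, ENNReal.inv_le_inv, ← ofReal_norm]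
      exact ENNReal.ofReal_le_ofReal (hgap x hx)
    · rw [intervalIntegral.integral_of_le (S.per_pos x hx).le]
      refine (enorm_integral_le_lintegral_enorm _).trans ?_
      exact lintegral_mono_set (Ioc_subset_Ioc_right (S.per_le x hx))
  have h2 : eLpNorm (fun x => (ENNReal.ofReal ε)⁻¹ * k x) p μ
      ≤ (ENNReal.ofReal ε)⁻¹ * eLpNorm k p μ := by
    have hp0 : p ≠ 0 := (zero_lt_one.trans_le hp1).ne'
    have hr0 : 0 < p.toReal := ENNReal.toReal_pos hp0 hp
    rw [eLpNorm_eq_lintegral_rpow_enorm_toReal hp0 hp, eLpNorm_eq_lintegral_rpow_enorm_toReal hp0 hp]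
    simp only [enorm_eq_self, ENNReal.mul_rpow_of_nonneg _ _ hr0.le, one_div]
    rw [lintegral_const_mul _ (hm.pow_const _),
      ENNReal.mul_rpow_of_nonneg _ _ (inv_nonneg.2 hr0.le), ← ENNReal.rpow_mul,
      mul_inv_cancel₀ hr0.ne', ENNReal.rpow_one]
  refine (eLpNorm_mono_enorm_ae h1).trans (h2.trans ?_)
  rw [mul_assoc]
  gcongr
  exact hKle g hg

lemma shift_res_ae (hm : ∀ x ∈ S.carrier, S.mult lam x ≠ 1) {g : α → ℂ} (hg : Measurable g)
    (hgp : eLpNorm g p μ ≠ ∞) :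
    ∀ᵐ x ∂μ, ∀ t, 0 ≤ t → S.shift lam t (S.res lam g) x
      = S.res lam g x - ∫ s in (0 : ℝ)..t, S.shift lam s g x := by
  filter_upwards [S.ae_mem, S.ae_intervalIntegrable_shift lam hp1 hp hg hgp] with x hx hi t ht
  rw [shift_res_eq lam hx, integral_turn_eq lam hx (hm x hx) t g ht hi]

lemma res_shift_ae (hm : ∀ x ∈ S.carrier, S.mult lam x ≠ 1) {g : α → ℂ} (hg : Measurable g)
    (hgp : eLpNorm g p μ ≠ ∞) :
    ∀ᵐ x ∂μ, ∀ t, 0 ≤ t → S.res lam (S.shift lam t g) x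
      = S.res lam g x - ∫ s in (0 : ℝ)..t, S.shift lam s g x := by
  filter_upwards [S.ae_mem, S.ae_intervalIntegrable_shift lam hp1 hp hg hgp] with x hx hi t ht
  rw [res_shift_eq lam hx, integral_turn_eq lam hx (hm x hx) t g ht hi]

lemma res_add_ae {f g : α → ℂ} (hf : Measurable f) (hfp : eLpNorm f p μ ≠ ∞)
    (hg : Measurable g) (hgp : eLpNorm g p μ ≠ ∞) :
    S.res lam (fun x => f x + g x) =ᵐ[μ] fun x => S.res lam f x + S.res lam g x := by
  filter_upwards [S.ae_mem, S.ae_intervalIntegrable_shift lam hp1 hp hf hfp,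
    S.ae_intervalIntegrable_shift lam hp1 hp hg hgp] with x hx h1 h2
  have hpx := (S.per_pos x hx).le
  simp only [res]
  rw [← mul_add, ← intervalIntegral.integral_add (h1 0 _ le_rfl hpx) (h2 0 _ le_rfl hpx)]
  simp only [shift, mul_add]

omit [SFinite μ] hp1 hp in
lemma res_mul (a : ℂ) (f : α → ℂ) (x : α) :
    S.res lam (fun y => a * f y) x = a * S.res lam f x := by
  simp only [res, shift]
  simp_rw [mul_left_comm _ a]
  rw [intervalIntegral.integral_const_mul]
  ring

/-! ### Strong continuity and averages over short times -/

omit [SFinite μ] in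
lemma tendsto_shift {g : α → ℂ} (hg : Measurable g) (hgp : eLpNorm g p μ ≠ ∞) :
    Tendsto (fun s => eLpNorm (fun x => S.shift lam s g x - g x) p μ) (𝓝[>] (0 : ℝ)) (𝓝 0) := by
  have hp0 : p ≠ 0 := (zero_lt_one.trans_le hp1).ne'
  have hr0 : 0 < p.toReal := ENNReal.toReal_pos hp0 hp
  set M := Real.exp ((‖lam‖ + |S.c|) * 1) with hM
  have hsmall : ∀ᶠ s : ℝ in 𝓝[>] 0, s ∈ Ioc (0 : ℝ) 1 := Ioc_mem_nhdsGT zero_lt_one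
  have hw : ∀ s : ℝ, Measurable (fun x => S.weight lam x s) := fun s =>
    (S.measurable_weight lam).comp (measurable_id.prodMk measurable_const)
  -- the weight is bounded, so the first part is controlled by the unweighted shift
  have h1 : Tendsto (fun s => eLpNorm (fun x => S.weight lam x s * (g (S.φ x s) - g x)) p μ)
      (𝓝[>] (0 : ℝ)) (𝓝 0) := by
    have hlim := ENNReal.Tendsto.const_mul (S.tendsto_φ g hg hgp)
      (Or.inr (ENNReal.ofReal_ne_top (r := M)))
    rw [mul_zero] at hlim
    refine tendsto_of_tendsto_of_tendsto_of_le_of_le' tendsto_const_nhds hlim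
      (Eventually.of_forall fun _ => zero_le) ?_
    filter_upwards [hsmall] with s hs
    refine eLpNorm_le_mul_eLpNorm_of_ae_le_mul ?_ p
    filter_upwards [S.ae_mem] with x hx
    rw [norm_mul]
    gcongr
    exact norm_weight_le lam hx hs.1.le hs.2
  have h2 : Tendsto (fun s => eLpNorm (fun x => (S.weight lam x s - 1) * g x) p μ)
      (𝓝[>] (0 : ℝ)) (𝓝 0) := by
    have hdom : Tendsto (fun s => ∫⁻ x, ‖(S.weight lam x s - 1) * g x‖ₑ ^ p.toReal ∂μ)
        (𝓝[>] (0 : ℝ)) (𝓝 (∫⁻ _, 0 ∂μ)) := by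
      refine tendsto_lintegral_filter_of_dominated_convergence
        (fun x => (ENNReal.ofReal (M + 1) * ‖g x‖ₑ) ^ p.toReal) ?_ ?_ ?_ ?_
      · exact Eventually.of_forall fun s =>
          (((hw s).sub measurable_const).mul hg).enorm.pow_const _
      · filter_upwards [hsmall] with s hs
        filter_upwards [S.ae_mem] with x hx
        rw [enorm_mul]
        gcongr
        rw [← ofReal_norm]
        refine ENNReal.ofReal_le_ofReal ((norm_sub_le _ _).trans ?_)
        rw [norm_one]
        gcongr
        exact norm_weight_le lam hx hs.1.le hs.2
      · simp_rw [ENNReal.mul_rpow_of_nonneg _ _ hr0.le]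
        rw [lintegral_const_mul _ (hg.enorm.pow_const _)]
        refine ENNReal.mul_ne_top (ENNReal.rpow_ne_top_of_nonneg hr0.le ENNReal.ofReal_ne_top) ?_
        exact ((eLpNorm_lt_top_iff_lintegral_rpow_enorm_lt_top hp0 hp).1 hgp.lt_top).ne
      · filter_upwards [S.ae_mem] with x hx
        have hc : Continuous fun s => ‖(S.weight lam x s - 1) * g x‖ₑ ^ p.toReal :=
          (ENNReal.continuous_rpow_const).comp
            (((continuous_weight lam hx).sub continuous_const).mul continuous_const).enorm
        have := (hc.tendsto 0).mono_left (nhdsWithin_le_nhds (s := Ioi 0))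
        simpa [weight_zero, hr0] using this
    simp_rw [eLpNorm_eq_lintegral_rpow_enorm_toReal hp0 hp]
    have := hdom.ennrpow_const (1 / p.toReal)
    simpa [hr0] using this
  have := tendsto_eLpNorm_add_zero (μ := μ) hp1
    (f := fun s x => S.weight lam x s * (g (S.φ x s) - g x))
    (g := fun s x => (S.weight lam x s - 1) * g x)
    (fun s => (hw s).mul ((hg.comp (S.measurable_φ_apply s)).sub hg))
    (fun s => ((hw s).sub measurable_const).mul hg) h1 h2
  refine this.congr fun s => ?_
  congr 1
  funext x
  rw [shift]
  ring

lemma tendsto_average_shift {g : α → ℂ} (hg : Measurable g) (hgp : eLpNorm g p μ ≠ ∞) :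
    Tendsto (fun t : ℝ => eLpNorm (fun x => (t : ℂ)⁻¹ * (∫ s in (0 : ℝ)..t, S.shift lam s g x)
      - g x) p μ) (𝓝[>] (0 : ℝ)) (𝓝 0) := by
  rw [ENNReal.tendsto_nhds_zero]
  intro δ hδ
  have hs := (ENNReal.tendsto_nhds_zero.1 (S.tendsto_shift lam hp1 hp hg hgp)) δ hδ
  obtain ⟨b, hb, hbs⟩ := mem_nhdsGT_iff_exists_Ioc_subset.1 hs
  filter_upwards [Ioc_mem_nhdsGT hb] with t ht
  have ht0 : 0 < t := ht.1
  have hm : Measurable (fun z : α × ℝ => ‖S.shift lam z.2 g z.1 - g z.1‖ₑ) :=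
    ((measurable_shift_uncurry hg).sub (hg.comp measurable_fst)).enorm
  have h1 := eLpNorm_lintegral_Ioc_le (μ := μ) hp1 hp
    (k := fun x s => ENNReal.ofReal t⁻¹ * ‖S.shift lam s g x - g x‖ₑ) (measurable_const.mul hm)
    (t := t) (D := ENNReal.ofReal t⁻¹ * δ) (fun s hs => by
      have := hbs ⟨hs.1, hs.2.trans ht.2⟩
      simp only [mem_ofPred_eq] at this
      have h2 := eLpNorm_const_smul (t⁻¹ : ℝ) (fun x => S.shift lam s g x - g x) p μ
      rw [Real.enorm_of_nonneg (inv_nonneg.2 ht0.le)] at h2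
      have h3 : eLpNorm (fun x => ENNReal.ofReal t⁻¹ * ‖S.shift lam s g x - g x‖ₑ) p μ
          = eLpNorm (t⁻¹ • fun x => S.shift lam s g x - g x) p μ := by
        refine eLpNorm_congr_enorm_ae (Eventually.of_forall fun x => ?_)
        rw [enorm_eq_self, Pi.smul_apply, enorm_smul, Real.enorm_of_nonneg (inv_nonneg.2 ht0.le)]
      rw [h3, h2]
      gcongr)
  rw [← mul_assoc, ← ENNReal.ofReal_mul ht0.le, mul_inv_cancel₀ ht0.ne', ENNReal.ofReal_one,
    one_mul] at h1
  refine le_trans (eLpNorm_mono_enorm_ae ?_) h1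
  filter_upwards [S.ae_intervalIntegrable_shift lam hp1 hp hg hgp] with x hx
  have hsub : (t : ℂ)⁻¹ * (∫ s in (0 : ℝ)..t, S.shift lam s g x) - g x
      = (t : ℂ)⁻¹ * ∫ s in (0 : ℝ)..t, (S.shift lam s g x - g x) := by
    have htc : (t : ℂ) ≠ 0 := by exact_mod_cast ht0.ne'
    rw [intervalIntegral.integral_sub (hx 0 t le_rfl ht0.le) intervalIntegrable_const,
      intervalIntegral.integral_const, sub_zero, Complex.real_smul]
    field_simp
  rw [hsub, enorm_mul, enorm_eq_self, lintegral_const_mul' _ _ ENNReal.ofReal_ne_top]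
  gcongr ?_ * ?_
  · rw [← Complex.ofReal_inv, ← ofReal_norm, Complex.norm_real, Real.norm_eq_abs,
      abs_of_pos (inv_pos.2 ht0)]
  · rw [intervalIntegral.integral_of_le ht0.le]
    exact enorm_integral_le_lintegral_enorm _

end PeriodicSystem

/-! ### The resolvent equation -/

lemma tendsto_exp_sub_one_div (a : ℂ) :
    Tendsto (fun t : ℝ => (Complex.exp (a * t) - 1) / t) (𝓝[>] 0) (𝓝 a) := by
  have h1 : HasDerivAt (fun t : ℝ => Complex.exp (a * t)) a 0 := by
    have h2 : HasDerivAt (fun z : ℂ => Complex.exp (a * z)) a ((0 : ℝ) : ℂ) := by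
      simpa using ((hasDerivAt_id ((0 : ℝ) : ℂ)).const_mul a).cexp
    exact h2.comp_ofReal
  have h3 := (hasDerivAt_iff_tendsto_slope.1 h1).mono_left
    (nhdsWithin_mono (0 : ℝ) (fun t (ht : 0 < t) => ht.ne'))
  refine h3.congr fun t => ?_
  simp [slope, div_eq_inv_mul]

lemma tendsto_exp_mul_ofReal (a : ℂ) :
    Tendsto (fun t : ℝ => Complex.exp (a * t)) (𝓝[>] 0) (𝓝 1) := by
  have hc : Continuous fun t : ℝ => Complex.exp (a * t) := by fun_prop
  simpa using (hc.tendsto 0).mono_left (nhdsWithin_le_nhds (s := Ioi 0))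

namespace PeriodicSystem

variable {α : Type*} [MeasurableSpace α] {μ : Measure α} {p : ℝ≥0∞} (S : PeriodicSystem μ p)
  (lam : ℂ) [SFinite μ] (hp1 : 1 ≤ p) (hp : p ≠ ∞)

include hp1 hp

/-- `u = res g` lies in the domain of the generator `T` of `U(t) = e^{λ t} shift t`, with
`T u = λ u - g`. -/
lemma tendsto_generator_res (hm : ∀ x ∈ S.carrier, S.mult lam x ≠ 1) {g : α → ℂ}
    (hg : Measurable g) (hgp : eLpNorm g p μ ≠ ∞) (hup : eLpNorm (S.res lam g) p μ ≠ ∞) :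
    Tendsto (fun t : ℝ => eLpNorm (fun x =>
      (Complex.exp (lam * t) * S.shift lam t (S.res lam g) x - S.res lam g x) / t
        - (lam * S.res lam g x - g x)) p μ) (𝓝[>] 0) (𝓝 0) := by
  set u := S.res lam g with hu
  have hum : Measurable u := measurable_res hg
  have hI := fun t => measurable_integral_shift (S := S) (lam := lam) hg t
  have h1 := tendsto_eLpNorm_mul_const_zero (μ := μ) (f := u)
    (by simpa using (tendsto_exp_sub_one_div lam).sub_const lam) hup
  have h2 := tendsto_eLpNorm_mul_zero (μ := μ) (tendsto_exp_mul_ofReal lam).neg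
    (S.tendsto_average_shift lam hp1 hp hg hgp)
  have h3 := tendsto_eLpNorm_mul_const_zero (μ := μ) (f := g)
    (by simpa using (tendsto_exp_mul_ofReal lam).const_sub 1) hgp
  have h12 := tendsto_eLpNorm_add_zero hp1 (fun t => measurable_const.mul hum)
    (fun t => measurable_const.mul ((measurable_const.mul (hI t)).sub hg)) h1 h2
  have h123 := tendsto_eLpNorm_add_zero hp1
    (fun t => (measurable_const.mul hum).add
      (measurable_const.mul ((measurable_const.mul (hI t)).sub hg)))
    (fun t => measurable_const.mul hg) h12 h3
  refine h123.congr' ?_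
  filter_upwards [self_mem_nhdsWithin] with t ht
  refine eLpNorm_congr_ae ?_
  filter_upwards [S.shift_res_ae lam hp1 hp hm hg hgp] with x hx
  simp only [Pi.mul_apply, Pi.add_apply, Pi.sub_apply]
  rw [hx t (le_of_lt ht), ← hu]
  have htc : (t : ℂ) ≠ 0 := by exact_mod_cast (ne_of_gt ht)
  field_simp
  ring

/-- If `f` lies in the domain of the generator `T` of `U(t) = e^{λ t} shift t`, then `res` maps
`λ f - T f` back to `f`: applied to the difference quotients of `shift t f`, the bounded operator
`res` yields minus the averages of `shift s f` over `(0, t)`, which tend to `-f`. -/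
lemma res_generator_ae {K : ℝ≥0∞} (hK : K ≠ ∞)
    (hKle : ∀ g : α → ℂ, Measurable g → eLpNorm (S.res lam g) p μ ≤ K * eLpNorm g p μ)
    (hm : ∀ x ∈ S.carrier, S.mult lam x ≠ 1) {f g : α → ℂ}
    (hf : Measurable f) (hfp : eLpNorm f p μ ≠ ∞) (hg : Measurable g) (hgp : eLpNorm g p μ ≠ ∞)
    (h : Tendsto (fun t : ℝ => eLpNorm (fun x =>
      (Complex.exp (lam * t) * S.shift lam t f x - f x) / t - g x) p μ) (𝓝[>] 0) (𝓝 0)) :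
    S.res lam (fun x => lam * f x - g x) =ᵐ[μ] f := by
  have hp0 : p ≠ 0 := (zero_lt_one.trans_le hp1).ne'
  have hI := fun t => measurable_integral_shift (S := S) (lam := lam) hf t
  have hS := fun t => measurable_shift (S := S) (lam := lam) hf t
  set w : α → ℂ := fun x => lam * f x - g x with hw
  have hwm : Measurable w := (measurable_const.mul hf).sub hg
  have hwp : eLpNorm w p μ ≠ ∞ :=
    ((MemLp.const_mul ⟨hf.aestronglyMeasurable, hfp.lt_top⟩ lam).sub
      ⟨hg.aestronglyMeasurable, hgp.lt_top⟩).2.ne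
  set d : ℝ → α → ℂ := fun t x =>
    (t : ℂ)⁻¹ * S.shift lam t f x + (-(t : ℂ)⁻¹ * f x + w x) with hd
  have hdm : ∀ t, Measurable (d t) := fun t =>
    (measurable_const.mul (hS t)).add ((measurable_const.mul hf).add hwm)
  -- the rescaled semigroup has the derivative `-w` at `0` along `f`
  have hd0 : Tendsto (fun t => eLpNorm (d t) p μ) (𝓝[>] 0) (𝓝 0) := by
    have h1 := tendsto_eLpNorm_mul_zero (μ := μ) (tendsto_exp_mul_ofReal (-lam)) h
    have h2 := tendsto_eLpNorm_mul_const_zero (μ := μ) (f := g)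
      (by simpa using (tendsto_exp_mul_ofReal (-lam)).sub_const 1) hgp
    have h3 := tendsto_eLpNorm_mul_const_zero (μ := μ) (f := f)
      (by simpa using (tendsto_exp_sub_one_div (-lam)).add_const lam) hfp
    have hm1 : ∀ t : ℝ, Measurable fun x => Complex.exp (-lam * t) *
        ((Complex.exp (lam * t) * S.shift lam t f x - f x) / t - g x) := fun t =>
      measurable_const.mul ((((measurable_const.mul (hS t)).sub hf).div_const _).sub hg)
    have h12 := tendsto_eLpNorm_add_zero hp1 hm1 (fun t => measurable_const.mul hg) h1 h2
    have h123 := tendsto_eLpNorm_add_zero hp1 (fun t => (hm1 t).add (measurable_const.mul hg))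
      (fun t => measurable_const.mul hf) h12 h3
    refine h123.congr' ?_
    filter_upwards [self_mem_nhdsWithin] with t ht
    congr 1
    funext x
    have htc : (t : ℂ) ≠ 0 := by exact_mod_cast (ne_of_gt ht)
    have he : Complex.exp (-lam * t) * Complex.exp (lam * t) = 1 := by
      rw [← Complex.exp_add]; simp
    simp only [hd, hw, Pi.mul_apply, Pi.add_apply]
    rw [neg_mul] at he ⊢
    field_simp
    linear_combination (S.shift lam t f x) * he
  have hres0 : Tendsto (fun t => eLpNorm (S.res lam (d t)) p μ) (𝓝[>] 0) (𝓝 0) := by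
    have := ENNReal.Tendsto.const_mul hd0 (Or.inr hK)
    rw [mul_zero] at this
    exact tendsto_of_tendsto_of_tendsto_of_le_of_le tendsto_const_nhds this
      (fun _ => zero_le) fun t => hKle _ (hdm t)
  have hrd : ∀ t : ℝ, 0 < t → S.res lam (d t) =ᵐ[μ]
      fun x => S.res lam w x - (t : ℂ)⁻¹ * ∫ s in (0 : ℝ)..t, S.shift lam s f x := by
    intro t ht
    obtain ⟨C, hC, hCle⟩ := S.exists_eLpNorm_shift_le lam hp t
    have hSp : eLpNorm (S.shift lam t f) p μ ≠ ∞ :=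
      ((hCle t ⟨ht.le, le_rfl⟩ f hf).trans_lt (ENNReal.mul_lt_top hC.lt_top hfp.lt_top)).ne
    have hcf : MemLp (fun x => -(t : ℂ)⁻¹ * f x) p μ :=
      MemLp.const_mul ⟨hf.aestronglyMeasurable, hfp.lt_top⟩ _
    have hcS : MemLp (fun x => (t : ℂ)⁻¹ * S.shift lam t f x) p μ :=
      MemLp.const_mul ⟨(hS t).aestronglyMeasurable, hSp.lt_top⟩ _
    have a1 := S.res_add_ae lam hp1 hp (f := fun x => (t : ℂ)⁻¹ * S.shift lam t f x)
      (g := fun x => -(t : ℂ)⁻¹ * f x + w x) (measurable_const.mul (hS t)) hcS.2.ne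
      ((measurable_const.mul hf).add hwm)
      (hcf.add ⟨hwm.aestronglyMeasurable, hwp.lt_top⟩).2.ne
    have a2 := S.res_add_ae lam hp1 hp (f := fun x => -(t : ℂ)⁻¹ * f x) (measurable_const.mul hf) hcf.2.ne hwm hwp
    filter_upwards [a1, a2, S.res_shift_ae lam hp1 hp hm hf hfp] with x h1 h2 h3
    simp only [hd]
    rw [h1, h2, res_mul, res_mul]
    have := h3 t ht.le
    rw [this]
    ring
  have havg := S.tendsto_average_shift lam hp1 hp hf hfp
  have hrm : Measurable (S.res lam w) := measurable_res hwm
  have hsum := tendsto_eLpNorm_add_zero hp1 (fun t => measurable_res (hdm t))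
    (fun t => (measurable_const.mul (hI t)).sub hf) hres0 havg
  have hconst : Tendsto (fun _ : ℝ => eLpNorm (fun x => S.res lam w x - f x) p μ) (𝓝[>] 0)
      (𝓝 0) := by
    refine hsum.congr' ?_
    filter_upwards [self_mem_nhdsWithin] with t ht
    refine eLpNorm_congr_ae ?_
    filter_upwards [hrd t ht] with x hx
    simp only [Pi.mul_apply, Pi.sub_apply]
    rw [hx]
    ring
  have hzero := tendsto_nhds_unique hconst tendsto_const_nhds
  rw [eq_comm, eLpNorm_eq_zero_iff (f := fun x => S.res lam w x - f x)
    (hrm.sub hf).aestronglyMeasurable hp0] at hzero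
  filter_upwards [hzero] with x hx
  exact sub_eq_zero.1 hx

end PeriodicSystem

/-! ### The periodic points and their periods -/

section Periodic

variable {N : ℕ} {F : E N → E N} {κ : ℝ≥0} {Ω : Set (E N)}

lemma mem_omegaThree_iff (hF : LipschitzWith κ F) {x : E N} :
    x ∈ omegaThree Ω F ↔ ∀ t : ℝ, flow F x t ∈ Ω := by
  simp only [omegaThree, tauPlus, tauMinus, mem_ofPred_eq, sInf_eq_top, forall_mem_image,
    EReal.coe_ne_top, imp_false, not_and, not_not]
  constructor
  · rintro ⟨h0, hp, hm⟩ t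
    rcases lt_trichotomy t 0 with ht | rfl | ht
    · simpa using hm (x := -t) (by linarith)
    · rwa [flow_zero hF]
    · exact hp ht
  · intro h
    exact ⟨by simpa [flow_zero hF] using h 0, fun _ _ => h _, fun _ _ => h _⟩

lemma flow_neg_eq_self_flow_iff (hF : LipschitzWith κ F) (x : E N) (s t : ℝ) :
    flow F (flow F x s) (-t) = flow F x s ↔ flow F x (-t) = x := by
  rw [flow_flow hF]
  constructor
  · intro h
    have := congrArg (fun y => flow F y (-s)) h
    simpa [flow_flow hF, flow_zero hF] using this
  · intro h
    conv_rhs => rw [← h]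
    rw [flow_flow hF, add_comm]

lemma primePeriod_flow (hF : LipschitzWith κ F) (x : E N) (s : ℝ) :
    primePeriod F (flow F x s) = primePeriod F x := by
  simp only [primePeriod, flow_neg_eq_self_flow_iff hF]

lemma flow_mem_omegaPerN (hF : LipschitzWith κ F) {n : ℕ} {x : E N} (hx : x ∈ omegaPerN Ω F n)
    (s : ℝ) : flow F x s ∈ omegaPerN Ω F n := by
  obtain ⟨⟨h3, hr, t, ht0, ht⟩, hn⟩ := hx
  have h3' := (mem_omegaThree_iff hF).1 h3
  have h3s : flow F x s ∈ omegaThree Ω F :=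
    (mem_omegaThree_iff hF).2 fun t => by rw [flow_flow hF]; exact h3' _
  refine ⟨⟨h3s, fun h => hr ⟨h3, fun t => ?_⟩, t, ht0, ?_⟩, ?_⟩
  · exact (flow_neg_eq_self_flow_iff hF x s t).1 (h.2 t)
  · exact (flow_neg_eq_self_flow_iff hF x s t).2 ht
  · rwa [primePeriod_flow hF]

lemma primePeriod_nonneg (x : E N) : 0 ≤ primePeriod F x :=
  Real.sInf_nonneg fun _ ht => ht.1.le

lemma flow_primePeriod (hF : LipschitzWith κ F) {x : E N} (hx : x ∈ omegaPer Ω F) :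
    flow F x (-primePeriod F x) = x := by
  obtain ⟨_, _, t, ht⟩ := hx
  have hc : IsClosed {t : ℝ | flow F x (-t) = x} :=
    isClosed_eq ((continuous_flow hF).comp (continuous_const.prodMk continuous_neg))
      continuous_const
  have hmem : primePeriod F x ∈ closure {t : ℝ | 0 < t ∧ flow F x (-t) = x} :=
    csInf_mem_closure ⟨t, ht⟩ ⟨0, fun _ h => h.1.le⟩
  exact hc.closure_subset_iff.2 (fun _ h => h.2) hmem

/-- Times in a compact interval return to the starting point only from a closed set of points. -/
lemma isClosed_exists_return (hF : LipschitzWith κ F) (a b : ℝ) :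
    IsClosed {x : E N | ∃ t ∈ Icc a b, flow F x (-t) = x} := by
  have hc : IsClosed {z : E N × Icc a b | flow F z.1 (-(z.2 : ℝ)) = z.1} :=
    isClosed_eq ((continuous_flow hF).comp
      (continuous_fst.prodMk (continuous_subtype_val.comp continuous_snd).neg)) continuous_fst
  convert! isClosedMap_fst_of_compactSpace _ hc using 1
  ext x
  simp

lemma measurable_primePeriod (hF : LipschitzWith κ F) :
    Measurable (primePeriod F : E N → ℝ) := by
  have hP : ∀ r : ℝ, MeasurableSet {x : E N | ∃ t, 0 < t ∧ t < r ∧ flow F x (-t) = x} := by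
    intro r
    have : {x : E N | ∃ t, 0 < t ∧ t < r ∧ flow F x (-t) = x} = ⋃ k : ℕ,
        {x : E N | ∃ t ∈ Icc (1 / ((k : ℝ) + 1)) (r - 1 / ((k : ℝ) + 1)), flow F x (-t) = x} := by
      ext x
      simp only [mem_ofPred_eq, mem_iUnion]
      constructor
      · rintro ⟨t, h0, hr, ht⟩
        obtain ⟨k, hk⟩ := exists_nat_one_div_lt (lt_min h0 (sub_pos.2 hr))
        have := hk.trans_le (min_le_left _ _)
        have := hk.trans_le (min_le_right _ _)
        exact ⟨k, t, ⟨by linarith, by linarith⟩, ht⟩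
      · rintro ⟨k, t, ⟨h1, h2⟩, ht⟩
        have : 0 < 1 / ((k : ℝ) + 1) := by positivity
        exact ⟨t, by linarith, by linarith, ht⟩
    rw [this]
    exact MeasurableSet.iUnion fun k => (isClosed_exists_return hF _ _).measurableSet
  refine measurable_of_Iio fun r => ?_
  rcases le_or_gt r 0 with hr | hr
  · convert! MeasurableSet.empty
    ext x
    simpa using hr.trans (primePeriod_nonneg x)
  -- `sInf ∅ = 0`, so the points that never return also satisfy `primePeriod F x < r`
  have : primePeriod F ⁻¹' Iio r = {x : E N | ∃ t, 0 < t ∧ t < r ∧ flow F x (-t) = x} ∪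
      (⋃ k : ℕ, {x : E N | ∃ t, 0 < t ∧ t < (k : ℝ) ∧ flow F x (-t) = x})ᶜ := by
    ext x
    simp only [mem_preimage, mem_Iio, mem_union, mem_ofPred_eq, mem_compl_iff, mem_iUnion]
    rcases eq_empty_or_nonempty {t : ℝ | 0 < t ∧ flow F x (-t) = x} with he | hne
    · have h0 : primePeriod F x = 0 := by rw [primePeriod, he, Real.sInf_empty]
      rw [h0]
      refine iff_of_true hr (Or.inr ?_)
      rintro ⟨k, t, ht0, _, ht⟩
      exact (he ▸ (⟨ht0, ht⟩ : t ∈ {t : ℝ | 0 < t ∧ flow F x (-t) = x}) : t ∈ (∅ : Set ℝ))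
    · rw [primePeriod, csInf_lt_iff ⟨0, fun _ h => h.1.le⟩ hne]
      constructor
      · rintro ⟨t, ⟨h0, ht⟩, hr⟩
        exact Or.inl ⟨t, h0, hr, ht⟩
      · rintro (⟨t, h0, hr, ht⟩ | h)
        · exact ⟨t, ⟨h0, ht⟩, hr⟩
        · obtain ⟨t, h0, ht⟩ := hne
          obtain ⟨k, hk⟩ := exists_nat_gt t
          exact absurd ⟨k, t, h0, hk, ht⟩ h
  rw [this]
  exact (hP r).union (MeasurableSet.iUnion fun k : ℕ => hP k).compl

lemma measurable_nu {h : E N → ℝ} (hmeas : Measurable h) : Measurable (nu F h) := by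
  refine hmeas.add (Finset.measurable_fun_sum _ fun i _ => ?_)
  have h1 : Measurable fun x => fderiv ℝ F x (EuclideanSpace.single i 1) :=
    measurable_fderiv_apply_const ℝ F _
  exact (EuclideanSpace.proj (𝕜 := ℝ) i).continuous.measurable.comp h1

lemma neg_le_divergence (hF : LipschitzWith κ F) (x : E N) : -(N * κ : ℝ) ≤ divergence F x := by
  have h1 : ∀ i : Fin N, -(κ : ℝ) ≤ (fderiv ℝ F x (EuclideanSpace.single i 1)) i := by
    intro i
    have h2 : ‖(fderiv ℝ F x (EuclideanSpace.single i 1)) i‖ ≤ κ := by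
      refine (PiLp.norm_apply_le _ i).trans ((ContinuousLinearMap.le_opNorm _ _).trans ?_)
      simpa using norm_fderiv_le_of_lipschitz ℝ hF
    exact (abs_le.1 h2).1
  have := Finset.sum_le_sum fun i (_ : i ∈ Finset.univ) => h1 i
  simpa [divergence] using this

lemma measurable_nu_flow (hF : LipschitzWith κ F) {h : E N → ℝ} (hmeas : Measurable h) :
    Measurable (fun z : E N × ℝ => nu F h (flow F z.1 (-z.2))) := by
  have h1 : Continuous (fun z : E N × ℝ => flow F z.1 (-z.2)) :=
    (continuous_flow hF).comp (continuous_fst.prodMk continuous_snd.neg)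
  exact (measurable_nu hmeas).comp h1.measurable

lemma measurable_multiplier (hF : LipschitzWith κ F) {h : E N → ℝ} (hmeas : Measurable h)
    (lam : ℂ) : Measurable (multiplier F h lam) := by
  have hp := measurable_primePeriod hF
  have h1 : Measurable (vartheta F h) :=
    (measurable_const.div hp).neg.mul
      (measurable_intervalIntegral_param (measurable_nu_flow hF hmeas) measurable_const hp)
  exact Complex.measurable_exp.comp ((Complex.measurable_ofReal.comp hp).neg.mul
    (measurable_const.sub (Complex.measurable_ofReal.comp h1)))

lemma periodic_nu_flow (hF : LipschitzWith κ F) (h : E N → ℝ) {x : E N}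
    (hx : x ∈ omegaPer Ω F) :
    Function.Periodic (fun s : ℝ => nu F h (flow F x (-s))) (primePeriod F x) := by
  intro s
  have : flow F x (-(s + primePeriod F x)) = flow F x (-s) := by
    conv_rhs => rw [← flow_primePeriod hF hx]
    rw [flow_flow hF, neg_add]
  simp only [this]

lemma multiplier_flow (hF : LipschitzWith κ F) (h : E N → ℝ) (lam : ℂ) {x : E N}
    (hx : x ∈ omegaPer Ω F) (s : ℝ) :
    multiplier F h lam (flow F x (-s)) = multiplier F h lam x := by
  have h1 : vartheta F h (flow F x (-s)) = vartheta F h x := by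
    simp only [vartheta, primePeriod_flow hF, flow_flow hF]
    congr 1
    have h2 := (periodic_nu_flow hF h hx).intervalIntegral_add_eq s 0
    have h3 := intervalIntegral.integral_comp_add_left (a := 0) (b := primePeriod F x)
      (fun s => nu F h (flow F x (-s))) s
    rw [zero_add] at h2
    rw [add_zero, h2] at h3
    rw [← h3]
    congr 1
    funext r
    rw [neg_add, add_comm]
  rw [multiplier, multiplier, h1, primePeriod_flow hF]

end Periodic

/-! ### A measurable invariant carrier -/

section Carrier

variable {N : ℕ} {F : E N → E N} {κ : ℝ≥0} {Ω : Set (E N)}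

/-- The points whose orbit meets a measurable set `K` during a set of times of positive measure
form a measurable invariant set containing almost all of `K`. -/
lemma exists_invariant_hull (hF : LipschitzWith κ F) {K : Set (E N)} (hK : MeasurableSet K) :
    ∃ A : Set (E N), MeasurableSet A ∧ (∀ x s, flow F x s ∈ A ↔ x ∈ A) ∧
      (∀ x ∈ A, ∃ s, flow F x s ∈ K) ∧ volume (K \ A) = 0 := by
  have hflow := (continuous_flow hF).measurable
  have hmeas : ∀ {D : Set (E N)}, MeasurableSet D →
      Measurable (fun z : E N × ℝ => D.indicator (1 : E N → ℝ≥0∞) (flow F z.1 z.2)) :=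
    fun hD => (measurable_one.indicator hD).comp hflow
  set I : E N → ℝ≥0∞ := fun x => ∫⁻ s : ℝ, K.indicator 1 (flow F x s) with hI
  have hIm : Measurable I := Measurable.lintegral_prod_right' (hmeas hK)
  have hinv : ∀ x s, I (flow F x s) = I x := by
    intro x s
    simp only [hI, flow_flow hF]
    exact lintegral_add_right_eq_self (fun r => K.indicator 1 (flow F x r)) s
  have hA : MeasurableSet {x | I x ≠ 0} := hIm (measurableSet_singleton 0).compl
  refine ⟨{x | I x ≠ 0}, hA, fun x s => by simp only [mem_ofPred_eq, hinv], ?_, ?_⟩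
  · intro x hx
    by_contra! hne
    refine hx ?_
    have : ∀ s, K.indicator (1 : E N → ℝ≥0∞) (flow F x s) = 0 := fun s =>
      indicator_of_notMem (hne s) _
    simp [hI, this]
  · set D := K \ {x | I x ≠ 0} with hD
    have hDm : MeasurableSet D := hK.diff hA
    -- no orbit spends a positive amount of time in `D`
    have h0 : ∀ x, ∫⁻ s : ℝ, D.indicator 1 (flow F x s) = 0 := by
      intro x
      by_cases hx : I x = 0
      · refine le_antisymm (le_trans (lintegral_mono fun s => ?_) hx.le) zero_le
        exact indicator_le_indicator_of_subset sdiff_subset (fun _ => zero_le) _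
      · have : ∀ s, D.indicator (1 : E N → ℝ≥0∞) (flow F x s) = 0 := fun s =>
          indicator_of_notMem (fun hs => hs.2 (by
            change I (flow F x s) ≠ 0
            rwa [hinv])) _
        simp [this]
    have h1 : ∫⁻ s : ℝ, ∫⁻ x, D.indicator (1 : E N → ℝ≥0∞) (flow F x s) = 0 := by
      rw [lintegral_lintegral_swap]
      · simp [h0]
      · exact ((hmeas hDm).comp measurable_swap).aemeasurable
    rw [lintegral_eq_zero_iff ((hmeas hDm).lintegral_prod_left')] at h1
    obtain ⟨s, hs⟩ := h1.exists
    have h2 : volume ((fun x => flow F x s) ⁻¹' D) = 0 := by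
      have h3 : Measurable fun x => flow F x s := hflow.comp measurable_prodMk_right
      have h4 : ∫⁻ x, ((fun x => flow F x s) ⁻¹' D).indicator 1 x = 0 := hs
      rwa [lintegral_indicator_one (h3 hDm)] at h4
    obtain ⟨C, -, hC⟩ := exists_volume_preimage_flow_le hF |s|
    have h5 := hC (-s) (by simp) ((fun x => flow F x s) ⁻¹' D)
    rw [h2, mul_zero] at h5
    have h6 : (fun x => flow F x (-s)) ⁻¹' ((fun x => flow F x s) ⁻¹' D) = D := by
      ext x
      simp [flow_flow hF, flow_zero hF]
    rw [h6] at h5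
    exact le_antisymm h5 zero_le

/-- `Ω_{per,n}` need not be Borel. It contains a Borel invariant set that carries every function
of `X_{per,n}` and on every orbit of which `ν` is integrable and the multiplier stays away
from `1`. -/
lemma exists_carrier (hF : LipschitzWith κ F) {h : E N → ℝ} (hmeas : Measurable h)
    (hint : ∀ᵐ x ∂(volume : Measure (E N)), x ∈ omegaPer Ω F →
        IntervalIntegrable (fun s : ℝ => nu F h (flow F x (-s))) volume 0 (primePeriod F x))
    (n : ℕ) {lam : ℂ} {ε : ℝ} (hε : 0 < ε)
    (hgap : volume {x | x ∈ omegaPerN Ω F n ∧ ‖multiplier F h lam x - 1‖ < ε} = 0) :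
    ∃ B : Set (E N), MeasurableSet B ∧ B ⊆ omegaPerN Ω F n ∧ (∀ x ∈ B, ∀ s, flow F x s ∈ B) ∧
      (∀ x ∈ B, ∀ a b, IntervalIntegrable (fun s : ℝ => nu F h (flow F x (-s))) volume a b) ∧
      (∀ x ∈ B, ε ≤ ‖multiplier F h lam x - 1‖) ∧
      ∀ D, MeasurableSet D → volume (D \ omegaPerN Ω F n) = 0 → volume (D \ B) = 0 := by
  set P := omegaPerN Ω F n with hP
  set K : Set (E N) := (toMeasurable volume Pᶜ)ᶜ with hKdef
  have hK : MeasurableSet K := (measurableSet_toMeasurable _ _).compl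
  -- `K` contains every measurable subset of `P` up to a null set
  have hKP : K ⊆ P := compl_subset_comm.1 (subset_toMeasurable _ _)
  obtain ⟨A, hA, hAinv, hAK, hKA⟩ := exists_invariant_hull hF hK
  have hAP : A ⊆ P := by
    intro x hx
    obtain ⟨s, hs⟩ := hAK x hx
    have := flow_mem_omegaPerN hF (hKP hs) (-s)
    simpa [flow_flow hF, flow_zero hF] using this
  set J : Set (E N) := ⋂ k : ℕ,
    {x | Integrable (fun s : ℝ => nu F h (flow F x (-s))) (volume.restrict (Ioc (-(k : ℝ)) k))}
    with hJ
  have hJm : MeasurableSet J := MeasurableSet.iInter fun k =>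
    measurableSet_integrable (measurable_nu_flow hF hmeas).stronglyMeasurable
  have hJiff : ∀ x, x ∈ J ↔ ∀ a b,
      IntervalIntegrable (fun s : ℝ => nu F h (flow F x (-s))) volume a b := by
    intro x
    simp only [hJ, mem_iInter, mem_ofPred_eq]
    constructor
    · intro H a b
      obtain ⟨k, hk⟩ := exists_nat_ge (max |a| |b|)
      have ha := (le_max_left _ _).trans hk
      have hb := (le_max_right _ _).trans hk
      rw [intervalIntegrable_iff]
      refine IntegrableOn.mono_set (H k) (Ioc_subset_Ioc (le_min ?_ ?_) (max_le ?_ ?_))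
      · exact (abs_le.1 ha).1
      · exact (abs_le.1 hb).1
      · exact (abs_le.1 ha).2
      · exact (abs_le.1 hb).2
    · intro H k
      exact (intervalIntegrable_iff_integrableOn_Ioc_of_le
        (by linarith [Nat.cast_nonneg (α := ℝ) k])).1 (H _ _)
  have hMm : MeasurableSet {x : E N | ε ≤ ‖multiplier F h lam x - 1‖} :=
    measurableSet_le measurable_const ((measurable_multiplier hF hmeas lam).sub_const 1).norm
  refine ⟨A ∩ J ∩ {x | ε ≤ ‖multiplier F h lam x - 1‖}, (hA.inter hJm).inter hMm,
    fun x hx => hAP hx.1.1, ?_, fun x hx => (hJiff x).1 hx.1.2, fun x hx => hx.2, ?_⟩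
  · rintro x ⟨⟨hxA, hxJ⟩, hxM⟩ s
    refine ⟨⟨(hAinv x s).2 hxA, (hJiff _).2 fun a b => ?_⟩, ?_⟩
    · have h1 := ((hJiff x).1 hxJ (a - s) (b - s)).comp_sub_right s
      rw [sub_add_cancel, sub_add_cancel] at h1
      refine h1.congr fun r _ => ?_
      simp only [flow_flow hF]
      rw [neg_sub, sub_eq_neg_add]
    · have := multiplier_flow hF h lam (hAP hxA).1 (-s)
      rw [neg_neg] at this
      change ε ≤ _
      rw [this]
      exact hxM
  · intro D hD hD0
    have h1 : volume (D \ K) = 0 := by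
      rw [hKdef, sdiff_eq, compl_compl, inter_comm, Measure.measure_toMeasurable_inter_of_sFinite hD,
        inter_comm]
      exact hD0
    have h2 : ∀ᵐ x ∂(volume : Measure (E N)), x ∉ D \ K := measure_eq_zero_iff_ae_notMem.1 h1
    have h3 : ∀ᵐ x ∂(volume : Measure (E N)), x ∉ K \ A := measure_eq_zero_iff_ae_notMem.1 hKA
    have h4 := measure_eq_zero_iff_ae_notMem.1 hgap
    refine measure_eq_zero_iff_ae_notMem.2 ?_
    filter_upwards [h2, h3, h4, hint] with x hx2 hx3 hx4 hx5
    rintro ⟨hxD, hxB⟩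
    have hxA : x ∈ A := by
      by_contra hA'
      exact hx3 ⟨by_contra fun hK' => hx2 ⟨hxD, hK'⟩, hA'⟩
    have hxM : ε ≤ ‖multiplier F h lam x - 1‖ :=
      le_of_not_gt fun hlt => hx4 ⟨hAP hxA, hlt⟩
    -- a vanishing period would force the multiplier to be `1`
    have hper : primePeriod F x ≠ 0 := by
      intro h0
      rw [multiplier, h0] at hxM
      simp at hxM
      linarith
    refine hxB ⟨⟨hxA, (hJiff x).2 fun a b => ?_⟩, hxM⟩
    exact (periodic_nu_flow hF h (hAP hxA).1).intervalIntegrable₀ hper (hx5 (hAP hxA).1) a b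

end Carrier

/-! ### Strong continuity of translation along the flow -/

section Translation

variable {N : ℕ} {F : E N → E N} {κ : ℝ≥0} {Ω B : Set (E N)} {p : ℝ≥0∞}

lemma exists_restrict_preimage_flow_le (hF : LipschitzWith κ F) (hB : MeasurableSet B)
    (hBinv : ∀ x ∈ B, ∀ s, flow F x s ∈ B) (t : ℝ) :
    ∃ C : ℝ≥0∞, C ≠ ∞ ∧ ∀ s ∈ Icc 0 t, ∀ A : Set (E N), MeasurableSet A →
      volume.restrict B ((fun x => flow F x (-s)) ⁻¹' A) ≤ C * volume.restrict B A := by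
  obtain ⟨C, hC, hCle⟩ := exists_volume_preimage_flow_le hF t
  refine ⟨C, hC, fun s hs A hA => ?_⟩
  rw [Measure.restrict_apply' hB, Measure.restrict_apply' hB]
  refine le_trans (measure_mono ?_)
    (hCle (-s) (by rw [abs_neg, abs_of_nonneg hs.1]; exact hs.2) (A ∩ B))
  exact fun x hx => ⟨hx.1, hBinv x hx.2 _⟩

lemma measurable_flow_neg (hF : LipschitzWith κ F) (s : ℝ) :
    Measurable (fun x => flow F x (-s)) := (lipschitzWith_flow hF (-s)).continuous.measurable

lemma tendsto_eLpNorm_comp_flow_sub_of_continuous (hF : LipschitzWith κ F) (hp1 : 1 ≤ p)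
    (hp : p ≠ ∞) {μ : Measure (E N)} [IsFiniteMeasureOnCompacts μ] {ψ : E N → ℂ}
    (hψ : Continuous ψ) (hψc : HasCompactSupport ψ) :
    Tendsto (fun s => eLpNorm (fun x => ψ (flow F x (-s)) - ψ x) p μ) (𝓝[>] (0 : ℝ)) (𝓝 0) := by
  have hp0 : p ≠ 0 := (zero_lt_one.trans_le hp1).ne'
  have hr0 : 0 < p.toReal := ENNReal.toReal_pos hp0 hp
  obtain ⟨M, hM⟩ := hψc.exists_bound_of_continuous hψ
  have hM0 : 0 ≤ M := (norm_nonneg _).trans (hM 0)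
  -- for `0 ≤ s ≤ 1` the difference lives on the compact set swept out by the support
  set K : Set (E N) := (fun z : E N × ℝ => flow F z.1 z.2) '' (tsupport ψ ×ˢ Icc 0 1) with hKdef
  have hK : IsCompact K := (hψc.isCompact.prod isCompact_Icc).image (continuous_flow hF)
  have hKm : MeasurableSet K := hK.measurableSet
  have hdom : Tendsto (fun s => ∫⁻ x, ‖ψ (flow F x (-s)) - ψ x‖ₑ ^ p.toReal ∂μ)
      (𝓝[>] (0 : ℝ)) (𝓝 (∫⁻ _, 0 ∂μ)) := by
    refine tendsto_lintegral_filter_of_dominated_convergence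
      (K.indicator fun _ => ENNReal.ofReal (2 * M) ^ p.toReal) ?_ ?_ ?_ ?_
    · exact Eventually.of_forall fun s => (((hψ.measurable.comp (measurable_flow_neg hF s)).sub
        hψ.measurable).enorm.pow_const _)
    · filter_upwards [Ioc_mem_nhdsGT zero_lt_one] with s hs
      refine Eventually.of_forall fun x => ?_
      by_cases hx : x ∈ K
      · rw [indicator_of_mem hx, ← ofReal_norm]
        gcongr
        refine (norm_sub_le _ _).trans ?_
        linarith [hM (flow F x (-s)), hM x]
      · have h1 : ψ x = 0 := by
          by_contra h0
          exact hx ⟨(x, 0), ⟨subset_tsupport _ h0, by simp⟩, flow_zero hF x⟩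
        have h2 : ψ (flow F x (-s)) = 0 := by
          by_contra h0
          exact hx ⟨(flow F x (-s), s), ⟨subset_tsupport _ h0, hs.1.le, hs.2⟩, by
            simp [flow_flow hF, flow_zero hF]⟩
        simp [h1, h2, hr0]
    · rw [lintegral_indicator hKm, lintegral_const, Measure.restrict_apply_univ]
      exact ENNReal.mul_ne_top (ENNReal.rpow_ne_top_of_nonneg hr0.le ENNReal.ofReal_ne_top)
        hK.measure_lt_top.ne
    · refine Eventually.of_forall fun x => ?_
      have h1 : Continuous fun s : ℝ => flow F x (-s) :=
        (continuous_flow hF).comp (continuous_const.prodMk continuous_neg)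
      have hc : Continuous fun s : ℝ => ‖ψ (flow F x (-s)) - ψ x‖ₑ ^ p.toReal :=
        ENNReal.continuous_rpow_const.comp ((hψ.comp h1).sub continuous_const).enorm
      have := (hc.tendsto 0).mono_left (nhdsWithin_le_nhds (s := Ioi 0))
      simpa [flow_zero hF, hr0] using this
  simp_rw [eLpNorm_eq_lintegral_rpow_enorm_toReal hp0 hp]
  have := hdom.ennrpow_const (1 / p.toReal)
  simpa [hr0] using this

/-- Strong continuity of translation along the flow, by approximation with compactly supported
continuous functions. -/
lemma tendsto_eLpNorm_comp_flow_sub (hF : LipschitzWith κ F) (hp1 : 1 ≤ p) (hp : p ≠ ∞)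
    (hB : MeasurableSet B) (hBinv : ∀ x ∈ B, ∀ s, flow F x s ∈ B) {g : E N → ℂ}
    (hg : Measurable g) (hgp : eLpNorm g p (volume.restrict B) ≠ ∞) :
    Tendsto (fun s => eLpNorm (fun x => g (flow F x (-s)) - g x) p (volume.restrict B))
      (𝓝[>] (0 : ℝ)) (𝓝 0) := by
  set μ : Measure (E N) := volume.restrict B with hμ
  obtain ⟨C, hC, hCle⟩ := exists_restrict_preimage_flow_le hF hB hBinv 1
  set L : ℝ≥0∞ := C ^ (1 / p).toReal with hL
  have hLtop : L ≠ ∞ := ENNReal.rpow_ne_top_of_nonneg ENNReal.toReal_nonneg hC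
  rw [ENNReal.tendsto_nhds_zero]
  intro δ hδ
  obtain ⟨η, hη0, hη⟩ : ∃ η : ℝ≥0∞, 0 < η ∧ (L + 1 + 1) * η ≤ δ := by
    have h2 : L + 1 + 1 ≠ ∞ := by simp [hLtop]
    rcases eq_or_ne δ ∞ with rfl | hδt
    · exact ⟨1, one_pos, le_top⟩
    · refine ⟨δ / (L + 1 + 1), ENNReal.div_pos hδ.ne' h2, ?_⟩
      exact ENNReal.mul_div_le
  obtain ⟨ψ, hψc, hψη, hψ, hψp⟩ := MemLp.exists_hasCompactSupport_eLpNorm_sub_le hp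
    (⟨hg.aestronglyMeasurable, hgp.lt_top⟩ : MemLp g p μ) hη0.ne'
  have hψlim := ENNReal.tendsto_nhds_zero.1
    (tendsto_eLpNorm_comp_flow_sub_of_continuous hF hp1 hp (μ := μ) hψ hψc) η hη0
  filter_upwards [hψlim, Ioc_mem_nhdsGT zero_lt_one] with s hs hs1
  have hdm : Measurable (g - ψ) := hg.sub hψ.measurable
  have hfl := measurable_flow_neg hF s
  have h1 : eLpNorm (fun x => (g - ψ) (flow F x (-s))) p μ ≤ L * η :=
    (eLpNorm_comp_le_of_preimage_le hp hfl (hCle s ⟨hs1.1.le, hs1.2⟩) hdm).trans (by gcongr)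
  have h2 : (fun x => g (flow F x (-s)) - g x) = ((fun x => (g - ψ) (flow F x (-s)))
      + fun x => ψ (flow F x (-s)) - ψ x) - (g - ψ) := by
    funext x
    simp only [Pi.add_apply, Pi.sub_apply]
    ring
  have m1 : Measurable (fun x => (g - ψ) (flow F x (-s))) := hdm.comp hfl
  have m2 : Measurable (fun x => ψ (flow F x (-s)) - ψ x) :=
    (hψ.measurable.comp hfl).sub hψ.measurable
  rw [h2]
  calc _ ≤ eLpNorm ((fun x => (g - ψ) (flow F x (-s))) + fun x => ψ (flow F x (-s)) - ψ x) p μ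
        + eLpNorm (g - ψ) p μ :=
        eLpNorm_sub_le (m1.add m2).aestronglyMeasurable hdm.aestronglyMeasurable hp1
    _ ≤ (L * η + η) + η := by
        gcongr
        exact (eLpNorm_add_le m1.aestronglyMeasurable m2.aestronglyMeasurable hp1).trans
          (add_le_add h1 hs)
    _ = (L + 1 + 1) * η := by ring
    _ ≤ δ := hη

end Translation

/-! ### The weighted shift on `X_{per,n}` and its generator -/

section Final

variable {N : ℕ} {F : E N → E N} {κ : ℝ≥0} {Ω B : Set (E N)} {h : E N → ℝ} {p : ℝ≥0∞} {n : ℕ}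

/-- The transport flow `φ_s = Φ(·, -s)` on the Borel carrier `B`. -/
noncomputable def transportSystem (hF : LipschitzWith κ F) (hmeas : Measurable h) {c : ℝ}
    (hc : ∀ x ∈ Ω, c ≤ h x) (hp1 : 1 ≤ p) (hp : p ≠ ∞) (hB : MeasurableSet B)
    (hBP : B ⊆ omegaPerN Ω F n) (hBinv : ∀ x ∈ B, ∀ s, flow F x s ∈ B)
    (hBper : ∀ x ∈ B, 0 < primePeriod F x)
    (hBint : ∀ x ∈ B, ∀ a b,
      IntervalIntegrable (fun s : ℝ => nu F h (flow F x (-s))) volume a b) :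
    PeriodicSystem (volume.restrict B) p where
  φ x s := flow F x (-s)
  ν := nu F h
  per := primePeriod F
  carrier := B
  T := n
  c := c - N * κ
  measurable_φ :=
    ((continuous_flow hF).comp (continuous_fst.prodMk continuous_snd.neg)).measurable
  measurable_ν := measurable_nu hmeas
  measurable_per := measurable_primePeriod hF
  φ_φ x s t := by rw [flow_flow hF, neg_add, add_comm]
  ae_mem := ae_restrict_mem hB
  φ_mem x hx s := hBinv x hx _
  per_pos := hBper
  per_le x hx := (hBP hx).2
  φ_per x hx := flow_primePeriod hF (hBP hx).1
  per_φ x _ s := primePeriod_flow hF x _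
  integrable_ν := hBint
  le_ν x hx := by
    have h1 := hc x (hBP hx).1.1.1
    have h2 := neg_le_divergence hF x
    rw [nu]
    linarith
  preimage_le := exists_restrict_preimage_flow_le hF hB hBinv
  tendsto_φ _ hg hgp := tendsto_eLpNorm_comp_flow_sub hF hp1 hp hB hBinv hg hgp

lemma eLpNorm_restrict_eq_of_ae_eq_zero (hB : MeasurableSet B) (hBΩ : B ⊆ Ω) {f : E N → ℂ}
    (hf : ∀ᵐ x ∂(volume : Measure (E N)).restrict Ω, x ∉ B → f x = 0) :
    eLpNorm f p (volume.restrict Ω) = eLpNorm f p (volume.restrict B) := by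
  have h1 : f =ᵐ[(volume : Measure (E N)).restrict Ω] B.indicator f := by
    filter_upwards [hf] with x hx
    by_cases hxB : x ∈ B
    · rw [indicator_of_mem hxB]
    · rw [indicator_of_notMem hxB, hx hxB]
  rw [eLpNorm_congr_ae h1, eLpNorm_indicator_eq_eLpNorm_restrict hB, Measure.restrict_restrict hB,
    inter_eq_self_of_subset_left hBΩ]

/-- For `x ∉ B` either the indicator in `U(t) f (x)` vanishes, or the point `Φ(x, -t)` lies in `Ω`
and, by invariance, outside `B`, where `f` vanishes. -/
lemma weightedShift_ae_eq_zero (hF : LipschitzWith κ F) (hΩ : MeasurableSet Ω)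
    (hBinv : ∀ x ∈ B, ∀ s, flow F x s ∈ B) {f : E N → ℂ}
    (hf : ∀ᵐ x ∂(volume : Measure (E N)).restrict Ω, x ∉ B → f x = 0) {t : ℝ} (ht : 0 < t) :
    ∀ᵐ x ∂(volume : Measure (E N)).restrict Ω, x ∉ B → weightedShift Ω F h t f x = 0 := by
  rw [ae_restrict_iff' hΩ] at hf
  obtain ⟨C, -, hC⟩ := exists_volume_preimage_flow_le hF t
  have h1 : ∀ᵐ x ∂(volume : Measure (E N)),
      flow F x (-t) ∈ Ω → flow F x (-t) ∉ B → f (flow F x (-t)) = 0 := by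
    rw [ae_iff] at hf ⊢
    have := hC (-t) (by rw [abs_neg, abs_of_pos ht]) {x | ¬(x ∈ Ω → x ∉ B → f x = 0)}
    rw [hf, mul_zero] at this
    exact le_antisymm this zero_le
  refine ae_restrict_of_ae ?_
  filter_upwards [h1] with x hx hxB
  have hφB : flow F x (-t) ∉ B := by
    intro hmem
    have := hBinv _ hmem t
    rw [flow_flow hF, add_neg_cancel, flow_zero hF] at this
    exact hxB this
  by_cases hτ : (t : EReal) < tauMinus Ω F x
  · have hmem : flow F x (-t) ∈ Ω := by
      by_contra hnot
      have hle : tauMinus Ω F x ≤ t := sInf_le ⟨t, ⟨ht, hnot⟩, rfl⟩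
      exact absurd hle (not_le.2 hτ)
    rw [weightedShift, hx hmem hφB]
    simp
  · rw [weightedShift, indicator_of_notMem (by exact hτ), mul_zero]

lemma weightedShift_eq_of_mem {μ : Measure (E N)} {S : PeriodicSystem μ p}
    (hφ : S.φ = fun x s => flow F x (-s)) (hν : S.ν = nu F h) (lam : ℂ) (f : E N → ℂ) {x : E N}
    (hx : x ∈ omegaThree Ω F) (t : ℝ) :
    weightedShift Ω F h t f x = Complex.exp (lam * t) * S.shift lam t f x := by
  have hτ : x ∈ {y : E N | (t : EReal) < tauMinus Ω F y} := by
    change (t : EReal) < tauMinus Ω F x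
    rw [hx.2.2]
    exact EReal.coe_lt_top t
  rw [weightedShift, indicator_of_mem hτ, PeriodicSystem.shift, PeriodicSystem.weight, hφ, hν,
    mul_one, ← mul_assoc, ← Complex.exp_add]
  congr 2
  push_cast
  congr 1
  ring

lemma mem_TperNGraph_iff (hF : LipschitzWith κ F) (hΩ : MeasurableSet Ω) (hB : MeasurableSet B)
    (hBP : B ⊆ omegaPerN Ω F n) (hBinv : ∀ x ∈ B, ∀ s, flow F x s ∈ B)
    {S : PeriodicSystem (volume.restrict B) p} (hφ : S.φ = fun x s => flow F x (-s))
    (hν : S.ν = nu F h) (lam : ℂ) [Fact (1 ≤ p)]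
    (hX : ∀ f : XperN Ω F p n, ∀ᵐ x ∂(volume : Measure (E N)).restrict Ω,
      x ∉ B → (f : Lp ℂ p (volume.restrict Ω)) x = 0)
    (fg : XperN Ω F p n × XperN Ω F p n) {f' g' : E N → ℂ}
    (hf : (fg.1 : Lp ℂ p (volume.restrict Ω)) =ᵐ[volume.restrict B] f')
    (hg : (fg.2 : Lp ℂ p (volume.restrict Ω)) =ᵐ[volume.restrict B] g') :
    fg ∈ TperNGraph Ω F h p n ↔
      Tendsto (fun t : ℝ => eLpNorm (fun x =>
        (Complex.exp (lam * t) * S.shift lam t f' x - f' x) / t - g' x) p (volume.restrict B))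
      (𝓝[>] 0) (𝓝 0) := by
  have hBΩ : B ⊆ Ω := fun x hx => (hBP hx).1.1.1
  refine tendsto_congr' ?_
  filter_upwards [self_mem_nhdsWithin] with t ht
  have ht0 : (0 : ℝ) < t := ht
  rw [eLpNorm_restrict_eq_of_ae_eq_zero hB hBΩ]
  · refine eLpNorm_congr_ae ?_
    filter_upwards [hf, hg, S.shift_congr_ae lam hf ht0.le, ae_restrict_mem hB] with x h1 h2 h3 hx
    rw [weightedShift_eq_of_mem hφ hν lam _ (hBP hx).1.1, h1, h2, h3]
  · filter_upwards [hX fg.1, hX fg.2, weightedShift_ae_eq_zero (h := h) hF hΩ hBinv (hX fg.1) ht0]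
      with x h1 h2 h3 hx
    rw [h1 hx, h2 hx, h3 hx]
    simp

lemma XperN_ae_eq_zero (hΩ : MeasurableSet Ω) [Fact (1 ≤ p)]
    (hBmax : ∀ D, MeasurableSet D → volume (D \ omegaPerN Ω F n) = 0 → volume (D \ B) = 0)
    (f : XperN Ω F p n) : ∀ᵐ x ∂(volume : Measure (E N)).restrict Ω,
      x ∉ B → (f : Lp ℂ p (volume.restrict Ω)) x = 0 := by
  obtain ⟨f, hf⟩ := f
  change ∀ᵐ x ∂(volume : Measure (E N)).restrict Ω, x ∉ omegaPerN Ω F n → f x = 0 at hf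
  change ∀ᵐ x ∂(volume : Measure (E N)).restrict Ω, x ∉ B → f x = 0
  have hD : MeasurableSet (Ω ∩ {x | f x ≠ 0}) :=
    hΩ.inter ((Lp.stronglyMeasurable f).measurable (measurableSet_singleton 0).compl)
  have h0 : volume ((Ω ∩ {x | f x ≠ 0}) \ omegaPerN Ω F n) = 0 := by
    rw [ae_restrict_iff' hΩ] at hf
    refine measure_eq_zero_iff_ae_notMem.2 ?_
    filter_upwards [hf] with x hx
    rintro ⟨⟨h1, h2⟩, h3⟩
    exact h2 (hx h1 h3)
  rw [ae_restrict_iff' hΩ]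
  filter_upwards [measure_eq_zero_iff_ae_notMem.1 (hBmax _ hD h0)] with x hx h1 h2
  by_contra h3
  exact hx ⟨⟨h1, h3⟩, h2⟩

/-- Elements of `X_{per,n}` are determined by their values on the carrier. -/
lemma XperN_ext (hB : MeasurableSet B) [Fact (1 ≤ p)]
    (hX : ∀ f : XperN Ω F p n, ∀ᵐ x ∂(volume : Measure (E N)).restrict Ω,
      x ∉ B → (f : Lp ℂ p (volume.restrict Ω)) x = 0) {f g : XperN Ω F p n}
    (hfg : ((f : Lp ℂ p (volume.restrict Ω)) : E N → ℂ)
      =ᵐ[volume.restrict B] (g : Lp ℂ p (volume.restrict Ω))) : f = g := by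
  refine Subtype.ext (Lp.ext ?_)
  have h1 := (ae_restrict_iff' hB).1 hfg
  filter_upwards [hX f, hX g, ae_restrict_of_ae h1] with x hf hg hx
  by_cases hxB : x ∈ B
  · exact hx hxB
  · rw [hf hxB, hg hxB]

lemma eLpNorm_coe_restrict_ne_top (hBΩ : B ⊆ Ω) [Fact (1 ≤ p)]
    (f : Lp ℂ p ((volume : Measure (E N)).restrict Ω)) :
    eLpNorm f p (volume.restrict B) ≠ ∞ :=
  ((eLpNorm_mono_measure f (Measure.restrict_mono_set _ hBΩ)).trans_lt (Lp.eLpNorm_lt_top f)).ne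

lemma measurable_coe (f : Lp ℂ p ((volume : Measure (E N)).restrict Ω)) : Measurable f :=
  (Lp.stronglyMeasurable f).measurable

lemma XperN_coe_add (hBΩ : B ⊆ Ω) [Fact (1 ≤ p)] (f g : XperN Ω F p n) :
    (((f + g : XperN Ω F p n) : Lp ℂ p (volume.restrict Ω)) : E N → ℂ)
      =ᵐ[volume.restrict B] fun x =>
        (f : Lp ℂ p (volume.restrict Ω)) x + (g : Lp ℂ p (volume.restrict Ω)) x :=
  ae_restrict_of_ae_restrict_of_subset hBΩ (Lp.coeFn_add (f : Lp ℂ p (volume.restrict Ω)) g)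

lemma XperN_coe_smul (hBΩ : B ⊆ Ω) [Fact (1 ≤ p)] (a : ℂ) (f : XperN Ω F p n) :
    (((a • f : XperN Ω F p n) : Lp ℂ p (volume.restrict Ω)) : E N → ℂ)
      =ᵐ[volume.restrict B] fun x => a * (f : Lp ℂ p (volume.restrict Ω)) x :=
  ae_restrict_of_ae_restrict_of_subset hBΩ (Lp.coeFn_smul a (f : Lp ℂ p (volume.restrict Ω)))

lemma XperN_coe_smul_sub (hBΩ : B ⊆ Ω) [Fact (1 ≤ p)] (a : ℂ) (f g : XperN Ω F p n) :
    (((a • f - g : XperN Ω F p n) : Lp ℂ p (volume.restrict Ω)) : E N → ℂ)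
      =ᵐ[volume.restrict B] fun x =>
        a * (f : Lp ℂ p (volume.restrict Ω)) x - (g : Lp ℂ p (volume.restrict Ω)) x := by
  have h3 : (((a • f - g : XperN Ω F p n) : Lp ℂ p (volume.restrict Ω)) : E N → ℂ)
      =ᵐ[volume.restrict B] _ :=
    ae_restrict_of_ae_restrict_of_subset hBΩ
      (Lp.coeFn_sub ((a • f : XperN Ω F p n) : Lp ℂ p (volume.restrict Ω)) g)
  filter_upwards [XperN_coe_smul hBΩ a f, h3] with x h1 h2
  rw [h2, Pi.sub_apply, h1]

/-- `res` acts as a bounded operator on `X_{per,n}`. -/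
lemma exists_resolvent_operator (hB : MeasurableSet B) (hBP : B ⊆ omegaPerN Ω F n)
    [hp1 : Fact (1 ≤ p)] (hp : p ≠ ∞)
    (hX : ∀ f : XperN Ω F p n, ∀ᵐ x ∂(volume : Measure (E N)).restrict Ω,
      x ∉ B → (f : Lp ℂ p (volume.restrict Ω)) x = 0)
    (S : PeriodicSystem (volume.restrict B) p) (lam : ℂ) {K : ℝ≥0∞} (hK : K ≠ ∞)
    (hKle : ∀ g : E N → ℂ, Measurable g →
      eLpNorm (S.res lam g) p (volume.restrict B) ≤ K * eLpNorm g p (volume.restrict B)) :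
    ∃ R : XperN Ω F p n →L[ℂ] XperN Ω F p n, ∀ g,
      ((R g : Lp ℂ p (volume.restrict Ω)) : E N → ℂ)
        =ᵐ[volume.restrict B] S.res lam (g : Lp ℂ p (volume.restrict Ω)) := by
  have hBΩ : B ⊆ Ω := fun x hx => (hBP hx).1.1.1
  have hnorm : ∀ g : E N → ℂ, eLpNorm (B.indicator (S.res lam g)) p (volume.restrict Ω)
      = eLpNorm (S.res lam g) p (volume.restrict B) := fun g => by
    rw [eLpNorm_restrict_eq_of_ae_eq_zero hB hBΩ
      (Eventually.of_forall fun x hx => indicator_of_notMem hx _),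
      eLpNorm_congr_ae (indicator_ae_eq_restrict hB)]
  have hmem : ∀ g : XperN Ω F p n,
      MemLp (B.indicator (S.res lam (g : Lp ℂ p (volume.restrict Ω)))) p (volume.restrict Ω) := by
    intro g
    refine ⟨((PeriodicSystem.measurable_res (measurable_coe _)).indicator hB).aestronglyMeasurable,
      ?_⟩
    rw [hnorm]
    exact (hKle _ (measurable_coe _)).trans_lt
      (ENNReal.mul_lt_top hK.lt_top (eLpNorm_coe_restrict_ne_top hBΩ _).lt_top)
  have hex : ∀ g : XperN Ω F p n, ∃ u : XperN Ω F p n, (u : Lp ℂ p (volume.restrict Ω))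
      = (hmem g).toLp _ := fun g => ⟨⟨(hmem g).toLp _, by
    change ∀ᵐ x ∂(volume : Measure (E N)).restrict Ω, _
    filter_upwards [(hmem g).coeFn_toLp] with x hx hxP
    rw [hx, indicator_of_notMem fun hxB => hxP (hBP hxB)]⟩, rfl⟩
  choose R₀ hR₀ using hex
  have hR₀B : ∀ g : XperN Ω F p n, ((R₀ g : Lp ℂ p (volume.restrict Ω)) : E N → ℂ)
      =ᵐ[volume.restrict B] S.res lam (g : Lp ℂ p (volume.restrict Ω)) := by
    intro g
    rw [hR₀]
    filter_upwards [ae_restrict_of_ae_restrict_of_subset hBΩ (hmem g).coeFn_toLp,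
      ae_restrict_mem hB] with x hx hxB
    rw [hx, indicator_of_mem hxB]
  have hadd : ∀ f g, R₀ (f + g) = R₀ f + R₀ g := by
    intro f g
    refine XperN_ext hB hX ?_
    filter_upwards [hR₀B (f + g), hR₀B f, hR₀B g, XperN_coe_add hBΩ (R₀ f) (R₀ g),
      S.res_congr_ae lam (XperN_coe_add hBΩ f g), S.res_add_ae lam hp1.out hp
        (measurable_coe (f : Lp ℂ p (volume.restrict Ω))) (eLpNorm_coe_restrict_ne_top hBΩ _)
        (measurable_coe (g : Lp ℂ p (volume.restrict Ω))) (eLpNorm_coe_restrict_ne_top hBΩ _)]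
      with x h1 h2 h3 h4 h5 h6
    rw [h1, h4, h2, h3, h5, h6]
  have hsmul : ∀ (a : ℂ) f, R₀ (a • f) = a • R₀ f := by
    intro a f
    refine XperN_ext hB hX ?_
    filter_upwards [hR₀B (a • f), hR₀B f, XperN_coe_smul hBΩ a (R₀ f),
      S.res_congr_ae lam (XperN_coe_smul hBΩ a f)] with x h1 h2 h3 h4
    rw [h1, h3, h2, h4, PeriodicSystem.res_mul]
  have hbound : ∀ g, ‖R₀ g‖ ≤ K.toReal * ‖g‖ := by
    intro g
    change ‖(R₀ g : Lp ℂ p (volume.restrict Ω))‖ ≤ K.toReal * ‖(g : Lp ℂ p (volume.restrict Ω))‖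
    rw [hR₀, Lp.norm_toLp, Lp.norm_def,
      ← ENNReal.toReal_mul, hnorm]
    refine ENNReal.toReal_mono (ENNReal.mul_ne_top hK (Lp.eLpNorm_ne_top _)) ?_
    refine (hKle _ (measurable_coe _)).trans ?_
    gcongr
  exact ⟨LinearMap.mkContinuous ⟨⟨R₀, hadd⟩, hsmul⟩ K.toReal hbound, hR₀B⟩

/-- If `1` keeps a distance `ε` from almost all values of the multiplier on `Ω_{per,n}`, then
`lam` belongs to the resolvent set. -/
lemma mem_resolventSet_of_gap (hΩ : MeasurableSet Ω) (hF : LipschitzWith κ F)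
    (hmeas : Measurable h) {c : ℝ} (hc : ∀ x ∈ Ω, c ≤ h x)
    (hint : ∀ᵐ x ∂(volume : Measure (E N)), x ∈ omegaPer Ω F →
        IntervalIntegrable (fun s : ℝ => nu F h (flow F x (-s))) volume 0 (primePeriod F x))
    [hp1 : Fact (1 ≤ p)] (hp : p ≠ ∞) {lam : ℂ} {ε : ℝ} (hε : 0 < ε)
    (hgap : volume {x | x ∈ omegaPerN Ω F n ∧ ‖multiplier F h lam x - 1‖ < ε} = 0) :
    lam ∈ resolventSetOfGraph (TperNGraph Ω F h p n) := by
  obtain ⟨B, hB, hBP, hBinv, hBint, hBgap, hBmax⟩ := exists_carrier hF hmeas hint n hε hgap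
  have hBΩ : B ⊆ Ω := fun x hx => (hBP hx).1.1.1
  have hper : ∀ x ∈ B, 0 < primePeriod F x := fun x hx => by
    refine lt_of_le_of_ne (primePeriod_nonneg x) fun h0 => ?_
    have := hBgap x hx
    rw [multiplier, ← h0] at this
    simp at this
    linarith
  obtain ⟨S, hφ, hν, hSper, hSB⟩ : ∃ S : PeriodicSystem (volume.restrict B) p,
      S.φ = (fun x s => flow F x (-s)) ∧ S.ν = nu F h ∧ S.per = primePeriod F ∧ S.carrier = B :=
    ⟨transportSystem hF hmeas hc hp1.out hp hB hBP hBinv hper hBint, rfl, rfl, rfl, rfl⟩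
  have hgap' : ∀ x ∈ S.carrier, ε ≤ ‖1 - S.mult lam x‖ := by
    intro x hx
    rw [hSB] at hx
    have hmult : S.mult lam x = multiplier F h lam x := by
      have hne : (primePeriod F x : ℂ) ≠ 0 := by exact_mod_cast (hper x hx).ne'
      rw [PeriodicSystem.mult, PeriodicSystem.weight, hφ, hν, hSper, multiplier, vartheta]
      congr 1
      push_cast
      field_simp
      ring
    rw [hmult, norm_sub_rev]
    exact hBgap x hx
  have hm : ∀ x ∈ S.carrier, S.mult lam x ≠ 1 := fun x hx h1 => by
    have := hgap' x hx
    rw [h1, sub_self, norm_zero] at this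
    linarith
  obtain ⟨K, hK, hKle⟩ := S.exists_eLpNorm_res_le lam hp1.out hp hε hgap'
  have hX := XperN_ae_eq_zero (p := p) hΩ hBmax
  obtain ⟨R, hR⟩ := exists_resolvent_operator hB hBP hp hX S lam hK hKle
  refine ⟨R, fun g => ?_, fun f g hfg => ?_⟩
  · have hgp := eLpNorm_coe_restrict_ne_top hBΩ (g : Lp ℂ p (volume.restrict Ω))
    have hup : eLpNorm (S.res lam (g : Lp ℂ p (volume.restrict Ω))) p (volume.restrict B) ≠ ∞ :=
      ((hKle _ (measurable_coe _)).trans_lt (ENNReal.mul_lt_top hK.lt_top hgp.lt_top)).ne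
    have h2 : (((lam • R g - g : XperN Ω F p n) : Lp ℂ p (volume.restrict Ω)) : E N → ℂ)
        =ᵐ[volume.restrict B] fun x => lam * S.res lam (g : Lp ℂ p (volume.restrict Ω)) x
          - (g : Lp ℂ p (volume.restrict Ω)) x := by
      filter_upwards [XperN_coe_smul_sub hBΩ lam (R g) g, hR g] with x h1 h2
      rw [h1, h2]
    exact (mem_TperNGraph_iff hF hΩ hB hBP hBinv hφ hν lam hX (R g, lam • R g - g) (hR g) h2).2
      (S.tendsto_generator_res lam hp1.out hp hm (measurable_coe _) hgp hup)
  · have h1 := (mem_TperNGraph_iff hF hΩ hB hBP hBinv hφ hν lam hX (f, g) ae_eq_rfl ae_eq_rfl).1 hfg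
    have h2 := S.res_generator_ae lam hp1.out hp hK hKle hm (measurable_coe _)
      (eLpNorm_coe_restrict_ne_top hBΩ _) (measurable_coe _) (eLpNorm_coe_restrict_ne_top hBΩ _) h1
    refine XperN_ext hB hX ?_
    filter_upwards [hR (lam • f - g), S.res_congr_ae lam (XperN_coe_smul_sub hBΩ lam f g), h2]
      with x h3 h4 h5
    exact h3.trans (h4.trans h5)

end Final

end PeriodicTransport

theorem mainTheorem9 {N : ℕ} (Ω : Set (PeriodicTransport.E N)) (hΩ : MeasurableSet Ω)
    (F : PeriodicTransport.E N → PeriodicTransport.E N) (κ : ℝ≥0) (hF : LipschitzWith κ F)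
    (h : PeriodicTransport.E N → ℝ) (hmeas : Measurable h) (hbelow : ∃ c : ℝ, ∀ x ∈ Ω, c ≤ h x)
    (hint : ∀ᵐ x ∂(volume : Measure (PeriodicTransport.E N)),
      x ∈ PeriodicTransport.omegaPer Ω F →
        IntervalIntegrable
          (fun s : ℝ => PeriodicTransport.nu F h (PeriodicTransport.flow F x (-s)))
          volume 0 (PeriodicTransport.primePeriod F x))
    (p : ℝ≥0∞) [Fact (1 ≤ p)] (hp : p ≠ ∞) (n : ℕ) :
    PeriodicTransport.spectrumOfGraph (PeriodicTransport.TperNGraph Ω F h p n) ⊆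
      {lam : ℂ | (1 : ℂ) ∈ PeriodicTransport.essRangeOn
        (volume : Measure (PeriodicTransport.E N)) (PeriodicTransport.omegaPerN Ω F n)
        (PeriodicTransport.multiplier F h lam)} := by
  intro lam hlam ε hε
  obtain ⟨c, hc⟩ := hbelow
  by_contra hnot
  exact hlam (PeriodicTransport.mem_resolventSet_of_gap hΩ hF hmeas hc hint hp hε
    (le_antisymm (not_lt.1 hnot) zero_le))
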